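/- **Setting.** Let $n,m\in\mathbb N$, $T>0$, let $\Omega\subset\mathbb R^n$ be compact, let $U\subset\mathbb R^m$ be non-empty and compact, and let $c:\mathbb R^n\times\mathbb R^m\times\mathbb R\to\mathbb R$, $g:\mathbb R^n\to\mathbb R$, $f:\mathbb R^n\times\mathbb R^m\to\mathbb R^n$ be such that $c$ is locally Lipschitz on $\Omega\times U\times[0,T]$, $g$ is locally Lipschitz on $\Omega$, and $f$ is locally Lipschitz on $\mathbb R^n\times U$, where locally Lipschitz on a set means Lipschitz on each of its compact subsets. For $\Omega'\subseteq\mathbb R^n$, $S\ge t_0\ge 0$ and $x_0\in\mathbb R^n$, let $\mathcal U_{\Omega',U,f,S}(x_0,t_0)$ be the set of measurable inputs $\mathbf u:[t_0,S]\to U$ for which there is a unique absolutely continuous solution $x=x(\,\cdot\,;x_0,t_0,\mathbf u):[t_0,S]\to\Omega'$ of $\dot x(t)=f(x(t),\mathbf u(t))$ for a.e. $t\in[t_0,S]$, $x(t_0)=x_0$. A function $V$ with extended real values is a value function if for all $(x,t)\in\Omega\times[0,T]$ $$V(x,t)=\inf_{\mathbf u\in\mathcal U_{\Omega,U,f,T}(x,t)}\Big\{\int_t^T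 c\big(x(s;x,t,\mathbf u),\mathbf u(s),s\big)\,ds+g\big(x(T;x,t,\mathbf u)\big)\Big\},\qquad \inf\emptyset=+\infty .$$ Let $\Lambda\subseteq\Omega$ be a bounded set from which, without state constraints, one cannot leave $\Omega$ up to time $T$: $$\{\,x(s;x_0,0,\mathbf u)\;:\;x_0\in\Lambda,\ s\in[0,T],\ \mathbf u\in\mathcal U_{\mathbb R^n,U,f,s}(x_0,0)\,\}\subseteq\Omega .$$ For a set $A\subseteq\mathbb R^n\times\mathbb R$, the weak first derivatives $D^\alpha F$ on $A$ of a function $F$ are the restrictions to $A$ of the weak derivatives, on some open set $O\supseteq A$, of a function on $O$ that agrees with $F$ on $A$ (they do not depend on the choices, up to null sets), and $\|F\|_{W^{1,p}(A)}=\big(\sum_{|\alpha|\le1}\int_A|D^\alpha F|^p\big)^{1/p}$, with value $\infty$ if there are no such derivatives. **Theorem.** Let $V$ be a value function. Then $V$ is finite on $\Lambda\times[0,T]$, and for every $p\in[1,\infty)$ and every $\varepsilon>0$ there is a polynomial $V_l:\mathbb R^n\times\mathbb R\to\mathbb R$ such that 1. $\|V-V_l\|_{W^{1,p}(\Lambda\times[0,T])}<\varepsilon$;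 2. $\sup_{(x,t)\in\Lambda\times[0,T]}|V(x,t)-V_l(x,t)|<\varepsilon$; 3. $V_l(x,t)\le V(x,t)$ for all $(x,t)\in\Omega\times[0,T]$; 4. $\nabla_tV_l(x,t)+c(x,u,t)+\nabla_xV_l(x,t)^{T}f(x,u)>0$ for all $x\in\Omega$, $u\in U$, $t\in(0,T)$; 5. $V_l(x,T)<g(x)$ for all $x\in\Omega$. -/

import Mathlib

open MeasureTheory Set
open scoped NNReal ENNReal ContDiff

noncomputable section

/-- The Euclidean space `ℝⁿ`. -/
abbrev Eu (n : ℕ) : Type := EuclideanSpace ℝ (Fin n)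

/-- `F` is locally Lipschitz on `s`: it is Lipschitz on every compact subset of `s`. -/
def LocLip {X Y : Type*} [PseudoEMetricSpace X] [PseudoEMetricSpace Y]
    (s : Set X) (F : X → Y) : Prop :=
  ∀ K : Set X, K ⊆ s → IsCompact K → ∃ L : ℝ≥0, LipschitzOnWith L F K

/-- The tuple `{c, g, f, Ω, U, T}` is a family of Lipschitz optimal control problems. -/
structure IsLipschitzOCP {n m : ℕ} (c : Eu n → Eu m → ℝ → ℝ) (g : Eu n → ℝ)
    (f : Eu n → Eu m → Eu n) (Ω : Set (Eu n)) (U : Set (Eu m)) (T : ℝ) : Prop where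
  locLip_c : LocLip (Ω ×ˢ U ×ˢ Icc 0 T) (fun z : Eu n × Eu m × ℝ => c z.1 z.2.1 z.2.2)
  locLip_g : LocLip Ω g
  locLip_f : LocLip (Ω ×ˢ U) (fun z : Eu n × Eu m => f z.1 z.2)
  isCompact_U : IsCompact U

/-- `x` is a (Carathéodory) solution on `[t₀, T]` of `x' = f(x, u)`, `x(t₀) = x₀`, that stays
in `Ω`; the differential equation is written in integrated form. -/
structure IsTrajectory {n m : ℕ} (f : Eu n → Eu m → Eu n) (Ω : Set (Eu n)) (T : ℝ)
    (x₀ : Eu n) (t₀ : ℝ) (u : ℝ → Eu m) (x : ℝ → Eu n) : Prop where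
  continuousOn : ContinuousOn x (Icc t₀ T)
  intervalIntegrable : IntervalIntegrable (fun s => f (x s) (u s)) volume t₀ T
  eq_integral : ∀ t ∈ Icc t₀ T, x t = x₀ + ∫ s in t₀..t, f (x s) (u s)
  mem : ∀ t ∈ Icc t₀ T, x t ∈ Ω

/-- The admissible inputs at `(x₀, t₀)`: measurable signals with values in `U` on `[t₀, T]` for
which there is a unique trajectory in `Ω` on `[t₀, T]` starting at `x₀`. -/
def admissible {n m : ℕ} (f : Eu n → Eu m → Eu n) (Ω : Set (Eu n)) (U : Set (Eu m)) (T : ℝ)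
    (x₀ : Eu n) (t₀ : ℝ) : Set (ℝ → Eu m) :=
  {u | Measurable u ∧ (∀ t ∈ Icc t₀ T, u t ∈ U) ∧
    ∃ x, IsTrajectory f Ω T x₀ t₀ u x ∧
      ∀ y, IsTrajectory f Ω T x₀ t₀ u y → EqOn y x (Icc t₀ T)}

/-- The optimal cost from `(x, t)`, an infimum in the extended reals, hence `⊤` if there is no
admissible input. (An admissible `u` determines its trajectory `φ` on `[t, T]`.) -/
def optimalCost {n m : ℕ} (c : Eu n → Eu m → ℝ → ℝ) (g : Eu n → ℝ)
    (f : Eu n → Eu m → Eu n) (Ω : Set (Eu n)) (U : Set (Eu m)) (T : ℝ)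
    (x : Eu n) (t : ℝ) : EReal :=
  ⨅ u ∈ admissible f Ω U T x t, ⨅ (φ : ℝ → Eu n) (_ : IsTrajectory f Ω T x t u φ),
    (((∫ s in t..T, c (φ s) (u s) s) + g (φ T) : ℝ) : EReal)

/-- `V` is a value function: it is the optimal cost on `Ω × [0, T]`. -/
def IsValueFunction {n m : ℕ} (c : Eu n → Eu m → ℝ → ℝ) (g : Eu n → ℝ)
    (f : Eu n → Eu m → Eu n) (Ω : Set (Eu n)) (U : Set (Eu m)) (T : ℝ)
    (V : Eu n → ℝ → EReal) : Prop :=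
  ∀ x ∈ Ω, ∀ t ∈ Icc 0 T, V x t = optimalCost c g f Ω U T x t

/-- The forward reachable set of `X₀` over the set `S` of times. -/
def forwardReach {n m : ℕ} (f : Eu n → Eu m → Eu n) (X₀ Ω : Set (Eu n)) (U : Set (Eu m))
    (S : Set ℝ) : Set (Eu n) :=
  {y | ∃ x ∈ X₀, ∃ s ∈ S, ∃ u ∈ admissible f Ω U s x 0,
    ∃ φ : ℝ → Eu n, IsTrajectory f Ω s x 0 u φ ∧ φ s = y}

/-- `H` is the weak derivative of `F` on the open set `O` in direction `v`. -/
structure IsWeakDeriv {n : ℕ} (O : Set (Eu n × ℝ)) (v : Eu n × ℝ) (F H : Eu n × ℝ → ℝ) :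
    Prop where
  locallyIntegrableOn : LocallyIntegrableOn F O volume
  locallyIntegrableOn_deriv : LocallyIntegrableOn H O volume
  integral_eq : ∀ α : Eu n × ℝ → ℝ, ContDiff ℝ ∞ α → HasCompactSupport α → tsupport α ⊆ O →
    ∫ z in O, F z * fderiv ℝ α z v = - ∫ z in O, H z * α z

/-- The `W^{1,p}` norm on a set `A ⊆ ℝⁿ × ℝ`, with value `∞` for functions not in `W^{1,p}(A)`.
Weak derivatives on `A` are those, on an open set `O ⊇ A`, of a function `G` that agrees with
`F` on `A`. Up to a null subset of `A` they do not depend on the choice of `O` and `G`, and if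
`A` is open they are the usual ones (`O = A`). -/
def sobolevNorm {n : ℕ} (A : Set (Eu n × ℝ)) (p : ℝ) (F : Eu n × ℝ → ℝ) : ℝ≥0∞ :=
  ⨅ (O : Set (Eu n × ℝ)) (G : Eu n × ℝ → ℝ) (Gx : Fin n → Eu n × ℝ → ℝ) (Gt : Eu n × ℝ → ℝ)
    (_ : IsOpen O ∧ A ⊆ O ∧ EqOn G F A ∧
      (∀ i, IsWeakDeriv O (EuclideanSpace.single i 1, 0) G (Gx i)) ∧
      IsWeakDeriv O (0, 1) G Gt),
    ((∫⁻ z in A, ‖G z‖ₑ ^ p) + (∑ i, ∫⁻ z in A, ‖Gx i z‖ₑ ^ p) + ∫⁻ z in A, ‖Gt z‖ₑ ^ p)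
      ^ (1 / p)

/-- The value at `(x, t)` of a polynomial in `x₁, …, xₙ` (the variables `inl i`) and `t`
(the variable `inr ()`). -/
def polyEval {n : ℕ} (P : MvPolynomial (Fin n ⊕ Unit) ℝ) (x : Eu n) (t : ℝ) : ℝ :=
  MvPolynomial.eval (Sum.elim (fun i => x i) (fun _ => t)) P

end

/-!
The value function is approximated from below by replacing the state-constrained problem with an
unconstrained one, whose value function is Lipschitz, and by convolving the latter with polynomials.

*The unconstrained problem.* On the compact sets that matter the data are Lipschitz, hence they
extend to bounded, globally Lipschitz data (`exists_isBoundedLipschitzOCP`). For such data every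
measurable input has a global trajectory (`exists_isTrajectory`), and the optimal cost
without state constraints, `freeValue`, is Lipschitz in state and time by Grönwall's inequality and
dynamic programming. Dropping the state constraint enlarges the set of competitors, so `freeValue`
is at most `V` on `Ω × [0, T]`; trajectories from `Λ` cannot leave `Ω`, so both agree on
`Λ × [0, T]` (`optimalCost_eq_freeValue`). Dynamic programming with constant inputs `v` gives
`∂ₜW + c(x, v, t) + ∇ₓW · f(x, v) ≥ 0` wherever `W = freeValue` is differentiable, thus almost
everywhere by Rademacher's theorem. Prolonging `W` beyond `T` with a large slope in time keeps this
inequality, which is then available on a full neighbourhood of `Ω × [0, T]`, and a truncation makes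
the function compactly supported (`exists_lipschitz_dissipative_minorant`).

*Polynomial approximation.* A Lipschitz function `w` with compact support is convolved with
polynomials that are uniformly close, on a large ball, to mollifiers `ρₖ`; the results are again
polynomials. Line derivatives of such a convolution fall on `w`, so that up to a uniformly small
error they are the averages `∂ᵥw ⋆ ρₖ`. These converge to `∂ᵥw` almost everywhere and boundedly,
hence in `L^p` on bounded sets, and they inherit lower bounds such as the dissipation inequality,
in which the coefficients may be frozen at the centre at the cost of an `O(1/k)` error
(`exists_polyEval_approx_lipschitz`). Adding `2σ(t - T - 1)` with `σ = O(1/k)` absorbs all errors: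
it raises the time derivative by `2σ` and lowers the values on `[0, T]` by at least `2σ`, which
makes the inequalities hold and keeps the approximation.
-/

/-! ### Grönwall's inequality and Carathéodory trajectories -/

/-- Grönwall's inequality in integral form. -/
theorem le_mul_exp_of_le_add_mul_integral {d : ℝ → ℝ} {a K t T : ℝ} (hK : 0 ≤ K)
    (hd : ContinuousOn d (Icc t T))
    (h : ∀ s ∈ Icc t T, d s ≤ a + K * ∫ r in t..s, d r) :
    ∀ s ∈ Icc t T, d s ≤ a * Real.exp (K * (s - t)) := by
  intro s hs
  have htT : t ≤ T := hs.1.trans hs.2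
  have hint : IntervalIntegrable d volume t T := by
    apply ContinuousOn.intervalIntegrable; rwa [uIcc_of_le htT]
  have hF : ContinuousOn (fun s => a + K * ∫ r in t..s, d r) (Icc t T) := by
    have := intervalIntegral.continuousOn_primitive_interval' hint left_mem_uIcc
    rw [uIcc_of_le htT] at this
    fun_prop
  have hF' : ∀ x ∈ Ico t T, HasDerivWithinAt (fun s => a + K * ∫ r in t..s, d r) (K * d x)
      (Ici x) x := by
    intro x hx
    have hx' : x ∈ Icc t T := Ico_subset_Icc_self hx
    have hc : ContinuousWithinAt d (Ici x) x :=
      (hd x hx').mono_of_mem_nhdsWithin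
        (Filter.mem_of_superset (Icc_mem_nhdsGE hx.2) (Icc_subset_Icc_left hx.1))
    have hm : StronglyMeasurableAtFilter d (nhdsWithin x (Ioi x)) volume :=
      ⟨Ioo x T, Ioo_mem_nhdsGT hx.2,
        (hd.mono ((Ioo_subset_Icc_self).trans (Icc_subset_Icc_left hx.1))).aestronglyMeasurable
          measurableSet_Ioo⟩
    have hi : IntervalIntegrable d volume t x :=
      hint.mono_set (by rw [uIcc_of_le htT, uIcc_of_le hx.1]; exact Icc_subset_Icc_right hx.2.le)
    exact ((intervalIntegral.integral_hasDerivWithinAt_right hi hm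
    (hc.mono Ioi_subset_Ici_self)).const_mul K).const_add a
  have key := le_gronwallBound_of_liminf_deriv_right_le (f := fun s => a + K * ∫ r in t..s, d r)
    (f' := fun s => K * d s) (δ := a) (K := K) (ε := 0) hF
    (fun x hx r hr => (hF' x hx).liminf_right_slope_le hr) (by simp)
    (fun x hx => by
      simpa using mul_le_mul_of_nonneg_left (h x (Ico_subset_Icc_self hx)) hK) s hs
  rw [gronwallBound_ε0] at key
  exact (h s hs).trans key

theorem intervalIntegrable_comp_of_bounded {n m : ℕ} {G : Type*} [NormedAddCommGroup G]
    {F : Eu n → Eu m → ℝ → G} {φ : ℝ → Eu n} {u : ℝ → Eu m} {t T C : ℝ}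
    (htT : t ≤ T) (hF : Continuous (fun z : Eu n × Eu m × ℝ => F z.1 z.2.1 z.2.2))
    (hφ : ContinuousOn φ (Icc t T)) (hu : Measurable u) (hC : ∀ x v s, ‖F x v s‖ ≤ C) :
    IntervalIntegrable (fun s => F (φ s) (u s) s) volume t T := by
  rw [intervalIntegrable_iff_integrableOn_Icc_of_le htT]
  have hm : AEStronglyMeasurable (fun s => F (φ s) (u s) s) (volume.restrict (Icc t T)) :=
    hF.comp_aestronglyMeasurable ((hφ.aestronglyMeasurable measurableSet_Icc).prodMk
      (hu.aestronglyMeasurable.prodMk measurable_id.aestronglyMeasurable))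
  exact Integrable.of_bound hm C (ae_of_all _ fun s => hC _ _ _)

namespace IsTrajectory

variable {n m : ℕ} {f f' : Eu n → Eu m → Eu n} {Ω Ω' : Set (Eu n)} {T s t : ℝ} {x y : Eu n}
  {u v : ℝ → Eu m} {φ ψ : ℝ → Eu n}

theorem initial (h : IsTrajectory f Ω T x t u φ) (htT : t ≤ T) : φ t = x := by
  simpa using h.eq_integral t (left_mem_Icc.2 htT)

theorem integrable_sub (h : IsTrajectory f Ω T x t u φ) {a b : ℝ} (hta : t ≤ a) (hab : a ≤ b)
    (hbT : b ≤ T) : IntervalIntegrable (fun s => f (φ s) (u s)) volume a b :=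
  h.intervalIntegrable.mono_set (by
    rw [uIcc_of_le hab, uIcc_of_le (hta.trans (hab.trans hbT))]; exact Icc_subset_Icc hta hbT)

theorem sub_eq_integral (h : IsTrajectory f Ω T x t u φ) {a b : ℝ} (hta : t ≤ a) (hab : a ≤ b)
    (hbT : b ≤ T) : φ b - φ a = ∫ s in a..b, f (φ s) (u s) := by
  rw [h.eq_integral b ⟨hta.trans hab, hbT⟩, h.eq_integral a ⟨hta, hab.trans hbT⟩,
    ← intervalIntegral.integral_add_adjacent_intervals
      (h.integrable_sub le_rfl hta (hab.trans hbT)) (h.integrable_sub hta hab hbT)]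
  abel

theorem restrict (h : IsTrajectory f Ω T x t u φ) (hts : t ≤ s) (hsT : s ≤ T) :
    IsTrajectory f Ω s x t u φ where
  continuousOn := h.continuousOn.mono (Icc_subset_Icc_right hsT)
  intervalIntegrable := h.integrable_sub le_rfl hts hsT
  eq_integral r hr := h.eq_integral r ⟨hr.1, hr.2.trans hsT⟩
  mem r hr := h.mem r ⟨hr.1, hr.2.trans hsT⟩

theorem tail (h : IsTrajectory f Ω T x t u φ) (hts : t ≤ s) (hsT : s ≤ T) :
    IsTrajectory f Ω T (φ s) s u φ where
  continuousOn := h.continuousOn.mono (Icc_subset_Icc_left hts)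
  intervalIntegrable := h.integrable_sub hts hsT le_rfl
  eq_integral r hr := by
    rw [← h.sub_eq_integral hts hr.1 hr.2]; abel
  mem r hr := h.mem r ⟨hts.trans hr.1, hr.2⟩

/-- Being a trajectory depends only on the velocities along the curve and on the values of the
curve on the time interval. -/
theorem congr (h : IsTrajectory f Ω T x t u φ) (htT : t ≤ T) (hφ : EqOn ψ φ (Icc t T))
    (hv : ∀ s ∈ Icc t T, f' (φ s) (v s) = f (φ s) (u s)) (hmem : ∀ s ∈ Icc t T, φ s ∈ Ω') :
    IsTrajectory f' Ω' T x t v ψ where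
  continuousOn := h.continuousOn.congr hφ
  intervalIntegrable := h.intervalIntegrable.congr fun s hs => by
    rw [uIoc_of_le htT] at hs
    have hs' := Ioc_subset_Icc_self hs
    simp only [hφ hs', hv s hs']
  eq_integral r hr := by
    rw [hφ hr, h.eq_integral r hr]
    congr 1
    refine intervalIntegral.integral_congr fun s hs => ?_
    rw [uIcc_of_le hr.1] at hs
    have hs' : s ∈ Icc t T := ⟨hs.1, hs.2.trans hr.2⟩
    simp only [hφ hs', hv s hs']
  mem r hr := by rw [hφ hr]; exact hmem r hr

theorem shift (h : IsTrajectory f Ω T x t u φ) (a : ℝ) :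
    IsTrajectory f Ω (T - a) x (t - a) (fun s => u (s + a)) (fun s => φ (s + a)) where
  continuousOn := h.continuousOn.comp (by fun_prop) fun s hs => by
    constructor <;> linarith [hs.1, hs.2]
  intervalIntegrable := h.intervalIntegrable.comp_add_right a
  eq_integral r hr := by
    rw [intervalIntegral.integral_comp_add_right (fun s => f (φ s) (u s)) a, sub_add_cancel]
    exact h.eq_integral _ (by constructor <;> linarith [hr.1, hr.2])
  mem r hr := h.mem _ (by constructor <;> linarith [hr.1, hr.2])

/-- Concatenation of two trajectories at the time `s`. -/
theorem concat (h : IsTrajectory f Ω s x t u φ) (h' : IsTrajectory f Ω T (φ s) s v ψ)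
    (hts : t ≤ s) (hsT : s ≤ T) :
    IsTrajectory f Ω T x t (fun r => if r ≤ s then u r else v r)
      (fun r => if r ≤ s then φ r else ψ r) := by
  have hψ : ψ s = φ s := h'.initial hsT
  set w : ℝ → Eu m := fun r => if r ≤ s then u r else v r
  set χ : ℝ → Eu n := fun r => if r ≤ s then φ r else ψ r
  have hχ1 : ∀ r, r ≤ s → f (χ r) (w r) = f (φ r) (u r) := fun r hr => by simp [χ, w, hr]
  have hχ2 : ∀ r, s < r → f (χ r) (w r) = f (ψ r) (v r) := fun r hr => by
    simp [χ, w, not_le.2 hr]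
  have hi1 : IntervalIntegrable (fun r => f (χ r) (w r)) volume t s :=
    h.intervalIntegrable.congr fun r hr => by
      rw [uIoc_of_le hts] at hr; exact (hχ1 r hr.2).symm
  have hi2 : IntervalIntegrable (fun r => f (χ r) (w r)) volume s T :=
    h'.intervalIntegrable.congr fun r hr => by
      rw [uIoc_of_le hsT] at hr; exact (hχ2 r hr.1).symm
  have e1 : ∀ r ∈ Icc t s, ∫ q in t..r, f (χ q) (w q) = ∫ q in t..r, f (φ q) (u q) := by
    intro r hr
    refine intervalIntegral.integral_congr fun q hq => ?_
    rw [uIcc_of_le hr.1] at hq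
    exact hχ1 q (hq.2.trans hr.2)
  refine ⟨?_, hi1.trans hi2, fun r hr => ?_, fun r hr => ?_⟩
  · rw [← Icc_union_Icc_eq_Icc hts hsT]
    refine ContinuousOn.union_of_isClosed ?_ ?_ isClosed_Icc isClosed_Icc
    · exact h.continuousOn.congr fun r hr => by simp [χ, hr.2]
    · refine h'.continuousOn.congr fun r hr => ?_
      rcases hr.1.eq_or_lt with rfl | hlt
      · simp [χ, hψ]
      · simp [χ, not_le.2 hlt]
  · rcases le_or_gt r s with hrs | hrs
    · rw [e1 r ⟨hr.1, hrs⟩, ← h.eq_integral r ⟨hr.1, hrs⟩]; simp [χ, hrs]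
    · have hi2' : IntervalIntegrable (fun r => f (χ r) (w r)) volume s r :=
        hi2.mono_set (by rw [uIcc_of_le hsT, uIcc_of_le hrs.le]; exact Icc_subset_Icc_right hr.2)
      have e2 : ∫ q in s..r, f (χ q) (w q) = ∫ q in s..r, f (ψ q) (v q) := by
        refine intervalIntegral.integral_congr_ae (ae_of_all _ fun q hq => ?_)
        rw [uIoc_of_le hrs.le] at hq
        exact hχ2 q hq.1
      rw [← intervalIntegral.integral_add_adjacent_intervals hi1 hi2', e1 s ⟨hts, le_rfl⟩, e2,
        ← add_assoc, ← h.eq_integral s ⟨hts, le_rfl⟩, ← h'.eq_integral r ⟨hrs.le, hr.2⟩]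
      simp [χ, not_le.2 hrs]
  · rcases le_or_gt r s with hrs | hrs
    · simpa [χ, hrs] using h.mem r ⟨hr.1, hrs⟩
    · simpa [χ, not_le.2 hrs] using h'.mem r ⟨hrs.le, hr.2⟩

theorem norm_sub_le (h : IsTrajectory f Ω T x t u φ) {C : ℝ} (hC : ∀ x v, ‖f x v‖ ≤ C)
    {a b : ℝ} (hta : t ≤ a) (hab : a ≤ b) (hbT : b ≤ T) : ‖φ b - φ a‖ ≤ C * (b - a) := by
  rw [h.sub_eq_integral hta hab hbT, ← abs_of_nonneg (sub_nonneg.2 hab)]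
  exact intervalIntegral.norm_integral_le_of_norm_le_const fun s _ => hC _ _

/-- Trajectories with the same input depend on the initial state in a Lipschitz way. -/
theorem dist_le_of_lipschitzOn {K : ℝ≥0} (h : IsTrajectory f Ω T x t u φ)
    (h' : IsTrajectory f Ω' T y t u ψ) {B : Set (Eu n)} {U : Set (Eu m)}
    (hf : LipschitzOnWith K (fun z : Eu n × Eu m => f z.1 z.2) (B ×ˢ U))
    (hφ : ∀ s ∈ Icc t T, φ s ∈ B) (hψ : ∀ s ∈ Icc t T, ψ s ∈ B) (hu : ∀ s ∈ Icc t T, u s ∈ U) :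
    ∀ s ∈ Icc t T, ‖φ s - ψ s‖ ≤ ‖x - y‖ * Real.exp (K * (s - t)) := by
  have hc : ContinuousOn (fun s => ‖φ s - ψ s‖) (Icc t T) :=
    (h.continuousOn.sub h'.continuousOn).norm
  refine le_mul_exp_of_le_add_mul_integral K.2 hc fun s hs => ?_
  have i1 := h.integrable_sub le_rfl hs.1 hs.2
  have i2 := h'.integrable_sub le_rfl hs.1 hs.2
  rw [h.eq_integral s hs, h'.eq_integral s hs, add_sub_add_comm,
    ← intervalIntegral.integral_sub i1 i2, ← intervalIntegral.integral_const_mul]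
  refine (norm_add_le _ _).trans (add_le_add le_rfl ?_)
  refine intervalIntegral.norm_integral_le_of_norm_le hs.1 (ae_of_all _ fun r hr => ?_) ?_
  · have hr' : r ∈ Icc t T := ⟨hr.1.le, hr.2.trans hs.2⟩
    have := hf.dist_le_mul (φ r, u r) ⟨hφ r hr', hu r hr'⟩ (ψ r, u r) ⟨hψ r hr', hu r hr'⟩
    simpa [Prod.dist_eq, dist_eq_norm] using this
  · refine (ContinuousOn.intervalIntegrable ?_).const_mul _
    rw [uIcc_of_le hs.1]
    exact hc.mono (Icc_subset_Icc_right hs.2)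

end IsTrajectory

/-! ### Existence of trajectories -/

/-- Existence of Carathéodory solutions for a bounded, globally Lipschitz vector field. In the
rescaled unknown `z(s) = exp (-l (s - t)) x(s)` the Picard operator is a contraction on the
whole of `[t, T]`, whatever its length. -/
theorem exists_isTrajectory {n m : ℕ} {f : Eu n → Eu m → Eu n} {K : ℝ≥0} {C : ℝ}
    (hf : LipschitzWith K (fun z : Eu n × Eu m => f z.1 z.2)) (hC : ∀ x v, ‖f x v‖ ≤ C)
    {u : ℝ → Eu m} (hu : Measurable u) {t T : ℝ} (htT : t ≤ T) (x : Eu n) :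
    ∃ φ, IsTrajectory f univ T x t u φ := by
  set l : ℝ := 2 * (K + 1) with hl
  have hK0 : (0 : ℝ) ≤ K := K.2
  have hlpos : 0 < l := by positivity
  let e : C(Icc t T, Eu n) → ℝ → Eu n :=
    fun z r => Real.exp (l * r - l * t) • z (projIcc t T htT r)
  have he : ∀ z, Continuous (e z) := fun z => by
    have : Continuous (projIcc t T htT) := continuous_projIcc
    fun_prop
  have hi : ∀ z, ∀ s ∈ Icc t T, IntervalIntegrable (fun r => f (e z r) (u r)) volume t s :=
    fun z s hs => intervalIntegrable_comp_of_bounded (F := fun x v _ => f x v) hs.1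
      (hf.continuous.comp (by fun_prop : Continuous fun z : Eu n × Eu m × ℝ => (z.1, z.2.1)))
      (he z).continuousOn hu (fun x v _ => hC x v)
  have hcont : ∀ z, Continuous fun s : Icc t T =>
      Real.exp (-(l * s - l * t)) • (x + ∫ r in t..s, f (e z r) (u r)) := by
    intro z
    have h1 := intervalIntegral.continuousOn_primitive_interval'
      (hi z T ⟨htT, le_rfl⟩) left_mem_uIcc
    rw [uIcc_of_le htT, continuousOn_iff_continuous_domRestrict] at h1
    have h2 : Continuous fun s : Icc t T => ∫ r in t..s, f (e z r) (u r) := h1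
    fun_prop
  let Φ : C(Icc t T, Eu n) → C(Icc t T, Eu n) := fun z => ⟨_, hcont z⟩
  have hΦ : ContractingWith (1 / 2) Φ := by
    refine ⟨by norm_num, LipschitzWith.of_dist_le_mul fun z w => ?_⟩
    rw [ContinuousMap.dist_le (by positivity)]
    intro s
    have hs := s.2
    have key : ‖∫ r in t..s, (f (e z r) (u r) - f (e w r) (u r))‖
        ≤ ∫ r in t..s, K * dist z w * Real.exp (l * r - l * t) := by
      refine intervalIntegral.norm_integral_le_of_norm_le hs.1 (ae_of_all _ fun r hr => ?_)
        (Continuous.intervalIntegrable (by fun_prop) _ _)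
      have h1 := hf.dist_le_mul (e z r, u r) (e w r, u r)
      have h2 : dist (e z r) (e w r) ≤ Real.exp (l * r - l * t) * dist z w := by
        simp only [e, dist_smul₀, Real.norm_eq_abs, Real.abs_exp]
        gcongr
        exact ContinuousMap.dist_apply_le_dist _
      rw [Prod.dist_eq, dist_self, max_eq_left dist_nonneg, dist_eq_norm] at h1
      calc _ ≤ _ := h1
        _ ≤ K * (Real.exp (l * r - l * t) * dist z w) := by gcongr
        _ = _ := by ring
    have hexp : ∫ r in t..s, K * dist z w * Real.exp (l * r - l * t)
        = K * dist z w * ((Real.exp (l * s - l * t) - 1) / l) := by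
      rw [intervalIntegral.integral_const_mul,
        intervalIntegral.integral_comp_mul_sub (fun y => Real.exp y) hlpos.ne', integral_exp]
      simp [div_eq_inv_mul]
    have hKl : (K : ℝ) / l ≤ 1 / 2 := by
      rw [div_le_div_iff₀ hlpos two_pos]; linarith
    have hE : Real.exp (-(l * s - l * t)) * (Real.exp (l * s - l * t) - 1) ≤ 1 := by
      rw [mul_sub, ← Real.exp_add, neg_add_cancel, Real.exp_zero, mul_one]
      linarith [Real.exp_pos (-(l * s - l * t))]
    change dist (Real.exp (-(l * s - l * t)) • (x + ∫ r in t..s, f (e z r) (u r)))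
      (Real.exp (-(l * s - l * t)) • (x + ∫ r in t..s, f (e w r) (u r))) ≤ _
    rw [dist_smul₀, dist_add_left, dist_eq_norm (∫ r in t..s, f (e z r) (u r)),
      ← intervalIntegral.integral_sub (hi z s hs) (hi w s hs), Real.norm_eq_abs, Real.abs_exp]
    rw [hexp] at key
    calc _ ≤ Real.exp (-(l * s - l * t)) *
          (K * dist z w * ((Real.exp (l * s - l * t) - 1) / l)) := by gcongr
      _ = (K / l) * (Real.exp (-(l * s - l * t)) * (Real.exp (l * s - l * t) - 1))
          * dist z w := by ring
      _ ≤ (1 / 2) * 1 * dist z w := by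
          gcongr
          exact mul_nonneg (Real.exp_pos _).le (by
            rw [sub_nonneg, Real.one_le_exp_iff]; nlinarith [hs.1])
      _ = _ := by simp
  let z := ContractingWith.fixedPoint Φ hΦ
  have hz : Φ z = z := hΦ.fixedPoint_isFixedPt
  have hzs : ∀ s ∈ Icc t T, e z s = x + ∫ r in t..s, f (e z r) (u r) := by
    intro s hs
    have h1 : Real.exp (-(l * s - l * t)) • (x + ∫ r in t..s, f (e z r) (u r)) = z ⟨s, hs⟩ :=
      congrArg (fun w : C(Icc t T, Eu n) => w ⟨s, hs⟩) hz
    have h2 : e z s = Real.exp (l * s - l * t) • z ⟨s, hs⟩ := by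
      simp only [e, projIcc_of_mem htT hs]
    rw [h2, ← h1, smul_smul, ← Real.exp_add, add_neg_cancel, Real.exp_zero, one_smul]
  exact ⟨e z, (he z).continuousOn, hi z T ⟨htT, le_rfl⟩, hzs, fun _ _ => mem_univ _⟩

/-! ### The value function without state constraints -/

/-- The data of an optimal control problem are bounded and Lipschitz on the whole space, all with
the same constant `K`. -/
structure IsBoundedLipschitzOCP {n m : ℕ} (K : ℝ≥0) (c : Eu n → Eu m → ℝ → ℝ) (g : Eu n → ℝ)
    (f : Eu n → Eu m → Eu n) : Prop where
  lip_c : LipschitzWith K (fun z : Eu n × Eu m × ℝ => c z.1 z.2.1 z.2.2)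
  lip_g : LipschitzWith K g
  lip_f : LipschitzWith K (fun z : Eu n × Eu m => f z.1 z.2)
  bound_c : ∀ x v s, |c x v s| ≤ K
  bound_g : ∀ x, |g x| ≤ K
  bound_f : ∀ x v, ‖f x v‖ ≤ K

/-- The costs attained from `(x, t)` without state constraints. Inputs are taken with values in
`U` at all times, not only on `[t, T]`, so that the set of inputs does not depend on `t`. -/
def costSet {n m : ℕ} (c : Eu n → Eu m → ℝ → ℝ) (g : Eu n → ℝ) (f : Eu n → Eu m → Eu n)
    (U : Set (Eu m)) (T : ℝ) (x : Eu n) (t : ℝ) : Set ℝ :=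
  {J | ∃ (u : ℝ → Eu m) (φ : ℝ → Eu n), Measurable u ∧ (∀ s, u s ∈ U) ∧
    IsTrajectory f univ T x t u φ ∧ J = (∫ s in t..T, c (φ s) (u s) s) + g (φ T)}

/-- The value function of the optimal control problem without state constraints, as a real number:
for bounded data and `t ≤ T` the infimum is over a non-empty set that is bounded below. -/
noncomputable def freeValue {n m : ℕ} (c : Eu n → Eu m → ℝ → ℝ) (g : Eu n → ℝ)
    (f : Eu n → Eu m → Eu n) (U : Set (Eu m)) (T : ℝ) (x : Eu n) (t : ℝ) : ℝ :=
  sInf (costSet c g f U T x t)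

/-- The value function without state constraints, extended to all times: constant in time before
`-1`, and with slope `K + K ^ 2` after `T`, which is steep enough for the dissipation inequality
to persist there. -/
noncomputable def extendedValue {n m : ℕ} (K : ℝ≥0) (c : Eu n → Eu m → ℝ → ℝ) (g : Eu n → ℝ)
    (f : Eu n → Eu m → Eu n) (U : Set (Eu m)) (T : ℝ) (z : Eu n × ℝ) : ℝ :=
  freeValue c g f U T z.1 (max (-1) (min T z.2)) + (K + K * K) * max (z.2 - T) 0

namespace IsBoundedLipschitzOCP

variable {n m : ℕ} {K : ℝ≥0} {c : Eu n → Eu m → ℝ → ℝ} {g : Eu n → ℝ} {f : Eu n → Eu m → Eu n}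
  {U : Set (Eu m)} {T t s : ℝ} {x y : Eu n} {u : ℝ → Eu m} {φ ψ : ℝ → Eu n}

theorem exists_trajectory (h : IsBoundedLipschitzOCP K c g f) (hu : Measurable u) (htT : t ≤ T)
    (x : Eu n) : ∃ φ, IsTrajectory f univ T x t u φ :=
  exists_isTrajectory h.lip_f h.bound_f hu htT x

theorem intervalIntegrable_cost (h : IsBoundedLipschitzOCP K c g f) (hu : Measurable u)
    (hφ : ContinuousOn φ (Icc t T)) (htT : t ≤ T) :
    IntervalIntegrable (fun s => c (φ s) (u s) s) volume t T :=
  intervalIntegrable_comp_of_bounded htT h.lip_c.continuous hφ hu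
    (fun x v s => by simpa using h.bound_c x v s)

theorem abs_integral_cost_le (h : IsBoundedLipschitzOCP K c g f) (htT : t ≤ T) :
    |∫ s in t..T, c (φ s) (u s) s| ≤ K * (T - t) := by
  rw [← abs_of_nonneg (sub_nonneg.2 htT)]
  exact intervalIntegral.norm_integral_le_of_norm_le_const
    fun s _ => (Real.norm_eq_abs _).trans_le (h.bound_c _ _ _)

theorem abs_le_of_mem_costSet (h : IsBoundedLipschitzOCP K c g f) (htT : t ≤ T) {J : ℝ}
    (hJ : J ∈ costSet c g f U T x t) : |J| ≤ K * (T - t) + K := by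
  obtain ⟨u, φ, -, -, -, rfl⟩ := hJ
  exact (abs_add_le _ _).trans (add_le_add (h.abs_integral_cost_le htT) (h.bound_g _))

theorem costSet_nonempty (h : IsBoundedLipschitzOCP K c g f) (hU : U.Nonempty) (htT : t ≤ T)
    (x : Eu n) : (costSet c g f U T x t).Nonempty := by
  obtain ⟨v, hv⟩ := hU
  obtain ⟨φ, hφ⟩ := h.exists_trajectory (u := fun _ => v) measurable_const htT x
  exact ⟨_, _, φ, measurable_const, fun _ => hv, hφ, rfl⟩

theorem costSet_bddBelow (h : IsBoundedLipschitzOCP K c g f) (htT : t ≤ T) :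
    BddBelow (costSet c g f U T x t) :=
  ⟨-(K * (T - t) + K), fun _ hJ => (abs_le.1 (h.abs_le_of_mem_costSet htT hJ)).1⟩

theorem freeValue_le (h : IsBoundedLipschitzOCP K c g f) (htT : t ≤ T) (hu : Measurable u)
    (huU : ∀ s, u s ∈ U) (hφ : IsTrajectory f univ T x t u φ) :
    freeValue c g f U T x t ≤ (∫ s in t..T, c (φ s) (u s) s) + g (φ T) :=
  csInf_le (h.costSet_bddBelow htT) ⟨u, φ, hu, huU, hφ, rfl⟩

theorem abs_freeValue_le (h : IsBoundedLipschitzOCP K c g f) (hU : U.Nonempty) (htT : t ≤ T) :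
    |freeValue c g f U T x t| ≤ K * (T - t) + K := by
  refine abs_le.2 ⟨le_csInf (h.costSet_nonempty hU htT x) fun J hJ =>
    (abs_le.1 (h.abs_le_of_mem_costSet htT hJ)).1, ?_⟩
  obtain ⟨J, hJ⟩ := h.costSet_nonempty hU htT x
  exact (csInf_le (h.costSet_bddBelow htT) hJ).trans (abs_le.1 (h.abs_le_of_mem_costSet htT hJ)).2

theorem freeValue_terminal (h : IsBoundedLipschitzOCP K c g f) (hU : U.Nonempty) :
    freeValue c g f U T x T = g x := by
  have : costSet c g f U T x T = {g x} := by
    refine (h.costSet_nonempty hU le_rfl x).subset_singleton_iff.1 ?_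
    rintro J ⟨u, φ, -, -, hφ, rfl⟩
    simp [hφ.initial le_rfl]
  rw [freeValue, this, csInf_singleton]

/-- Half of the dynamic programming principle: following any input up to the time `s` and
optimally afterwards costs at least the optimal value. -/
theorem freeValue_le_integral_add (h : IsBoundedLipschitzOCP K c g f) (hU : U.Nonempty)
    (hts : t ≤ s) (hsT : s ≤ T) (hu : Measurable u) (huU : ∀ s, u s ∈ U)
    (hφ : IsTrajectory f univ s x t u φ) :
    freeValue c g f U T x t ≤ (∫ r in t..s, c (φ r) (u r) r) + freeValue c g f U T (φ s) s := by
  rw [← sub_le_iff_le_add']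
  refine le_csInf (h.costSet_nonempty hU hsT (φ s)) ?_
  rintro J ⟨v, ψ, hv, hvU, hψ, rfl⟩
  have hw := h.freeValue_le (hts.trans hsT)
    (Measurable.ite (measurableSet_Iic (a := s)) hu hv)
    (fun r => by
      by_cases hr : r ≤ s
      · simpa [hr] using huU r
      · simpa [hr] using hvU r)
    (hφ.concat hψ hts hsT)
  -- also if `s = T`, where the concatenation takes the value of its first piece
  have hend : (if T ≤ s then φ T else ψ T) = ψ T := by
    split_ifs with hT
    · obtain rfl : T = s := le_antisymm hT hsT
      exact (hψ.initial le_rfl).symm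
    · rfl
  have e1 : EqOn (fun r => c (if r ≤ s then φ r else ψ r) (if r ≤ s then u r else v r) r)
      (fun r => c (φ r) (u r) r) (uIoc t s) := fun r hr => by
    rw [uIoc_of_le hts] at hr
    simp [hr.2]
  have e2 : EqOn (fun r => c (if r ≤ s then φ r else ψ r) (if r ≤ s then u r else v r) r)
      (fun r => c (ψ r) (v r) r) (uIoc s T) := fun r hr => by
    rw [uIoc_of_le hsT] at hr
    simp [not_le.2 hr.1]
  have i1 := h.intervalIntegrable_cost hu hφ.continuousOn hts
  have i2 := h.intervalIntegrable_cost hv hψ.continuousOn hsT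
  have hsplit := intervalIntegral.integral_add_adjacent_intervals (i1.congr e1.symm)
    (i2.congr e2.symm)
  rw [intervalIntegral.integral_congr_ae (ae_of_all _ e1),
    intervalIntegral.integral_congr_ae (ae_of_all _ e2)] at hsplit
  rw [hend, ← hsplit] at hw
  linarith

/-- A common Lipschitz constant in the state for the unconstrained value functions at the times
in `[-1, T]`. -/
theorem freeValue_sub_le (h : IsBoundedLipschitzOCP K c g f) (hU : U.Nonempty)
    (ht : t ∈ Icc (-1) T) (x y : Eu n) :
    freeValue c g f U T x t - freeValue c g f U T y t
      ≤ (K * (T + 1) + K) * Real.exp (K * (T + 1)) * ‖x - y‖ := by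
  have hK : (0 : ℝ) ≤ K := K.2
  have htT : t ≤ T := ht.2
  have hT1 : 0 ≤ T + 1 := by linarith [ht.1, ht.2]
  rw [sub_le_comm]
  refine le_csInf (h.costSet_nonempty hU htT y) ?_
  rintro J ⟨u, ψ, hu, huU, hψ, rfl⟩
  obtain ⟨φ, hφ⟩ := h.exists_trajectory hu htT x
  have hV := h.freeValue_le htT hu huU hφ
  set D := ‖x - y‖ * Real.exp (K * (T + 1))
  have hD0 : 0 ≤ D := by positivity
  have hd : ∀ s ∈ Icc t T, ‖φ s - ψ s‖ ≤ D := fun s hs =>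
    (hφ.dist_le_of_lipschitzOn hψ (h.lip_f.lipschitzOnWith (s := univ ×ˢ univ))
      (fun _ _ => mem_univ _) (fun _ _ => mem_univ _) (fun _ _ => mem_univ _) s hs).trans (by
        simp only [D]; gcongr; linarith [hs.2, ht.1])
  have hg : g (φ T) - g (ψ T) ≤ K * D := by
    have := h.lip_g.dist_le_mul (φ T) (ψ T)
    rw [Real.dist_eq, dist_eq_norm] at this
    exact (le_abs_self _).trans (this.trans
      (mul_le_mul_of_nonneg_left (hd T (right_mem_Icc.2 htT)) hK))
  have hc : (∫ s in t..T, c (φ s) (u s) s) - ∫ s in t..T, c (ψ s) (u s) s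
      ≤ K * D * (T + 1) := by
    rw [← intervalIntegral.integral_sub (h.intervalIntegrable_cost hu hφ.continuousOn htT)
      (h.intervalIntegrable_cost hu hψ.continuousOn htT)]
    refine (Real.le_norm_self _).trans
      ((intervalIntegral.norm_integral_le_of_norm_le_const (C := K * D) fun s hs => ?_).trans ?_)
    · rw [uIoc_of_le htT] at hs
      have h1 := h.lip_c.dist_le_mul (φ s, u s, s) (ψ s, u s, s)
      rw [Prod.dist_eq, dist_self, max_eq_left dist_nonneg, dist_eq_norm, dist_eq_norm] at h1
      exact h1.trans (mul_le_mul_of_nonneg_left (hd s (Ioc_subset_Icc_self hs)) hK)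
    · rw [abs_of_nonneg (sub_nonneg.2 htT)]
      gcongr
      linarith [ht.1]
  have : (K * (T + 1) + K) * Real.exp (K * (T + 1)) * ‖x - y‖ = K * D * (T + 1) + K * D := by
    simp only [D]; ring
  linarith

/-- Lipschitz continuity in time, by dynamic programming over `[t, s]`: in that time both the
running cost and the state change by `O(s - t)`. -/
theorem abs_freeValue_sub_le_time (h : IsBoundedLipschitzOCP K c g f) (hU : U.Nonempty)
    (ht : -1 ≤ t) (hts : t ≤ s) (hsT : s ≤ T) (x : Eu n) :
    |freeValue c g f U T x t - freeValue c g f U T x s|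
      ≤ (K + (K * (T + 1) + K) * Real.exp (K * (T + 1)) * K) * (s - t) := by
  have hK : (0 : ℝ) ≤ K := K.2
  have htT := hts.trans hsT
  have hT1 : 0 ≤ T + 1 := by linarith
  set L := (K * (T + 1) + K) * Real.exp (K * (T + 1))
  have hL : 0 ≤ L := by positivity
  have hs : s ∈ Icc (-1) T := ⟨by linarith, hsT⟩
  have hstep : ∀ {u φ}, IsTrajectory f univ s x t u φ → L * ‖φ s - x‖ ≤ L * (K * (s - t)) :=
    fun {u φ} hφ => by
      have := hφ.norm_sub_le h.bound_f le_rfl hts le_rfl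
      rw [hφ.initial hts] at this
      gcongr
  rw [abs_sub_le_iff]
  constructor
  · obtain ⟨v, hv⟩ := hU
    obtain ⟨φ, hφ⟩ := h.exists_trajectory (u := fun _ => v) measurable_const hts x
    have h1 := h.freeValue_le_integral_add ⟨v, hv⟩ hts hsT measurable_const (fun _ => hv) hφ
    have h2 := (abs_le.1 (h.abs_integral_cost_le (φ := φ) (u := fun _ => v) hts)).2
    have h3 := h.freeValue_sub_le (U := U) ⟨v, hv⟩ hs (φ s) x
    have h4 := hstep hφ
    linarith
  · rw [sub_le_comm]
    refine le_csInf (h.costSet_nonempty hU htT x) ?_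
    rintro J ⟨u, φ, hu, huU, hφ, rfl⟩
    have h1 := h.freeValue_le hsT hu huU (hφ.tail hts hsT)
    have h2 := (abs_le.1 (h.abs_integral_cost_le (φ := φ) (u := u) hts)).1
    have h3 := h.freeValue_sub_le hU hs x (φ s)
    have h4 := hstep (hφ.restrict hts hsT)
    rw [norm_sub_rev] at h4
    have h5 := intervalIntegral.integral_add_adjacent_intervals
      (h.intervalIntegrable_cost hu (hφ.restrict hts hsT).continuousOn hts)
      (h.intervalIntegrable_cost hu (hφ.tail hts hsT).continuousOn hsT)
    linarith

theorem exists_lipschitzWith_extendedValue (h : IsBoundedLipschitzOCP K c g f)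
    (hU : U.Nonempty) (hT : 0 < T) : ∃ L, LipschitzWith L (extendedValue K c g f U T) := by
  have hK : (0 : ℝ) ≤ K := K.2
  have hclamp : ∀ r : ℝ, max (-1) (min T r) ∈ Icc (-1) T := fun r =>
    ⟨le_max_left _ _, max_le (by linarith) (min_le_left _ _)⟩
  let A : ℝ≥0 := Real.toNNReal ((K * (T + 1) + K) * Real.exp (K * (T + 1)))
  let B : ℝ≥0 := Real.toNNReal (K + (K * (T + 1) + K) * Real.exp (K * (T + 1)) * K)
  have hA : (A : ℝ) = (K * (T + 1) + K) * Real.exp (K * (T + 1)) :=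
    Real.coe_toNNReal _ (by positivity)
  have hB : (B : ℝ) = K + (K * (T + 1) + K) * Real.exp (K * (T + 1)) * K :=
    Real.coe_toNNReal _ (by positivity)
  have hlip1 : LipschitzWith 1 (fun r : ℝ => max (-1) (min T r)) :=
    (LipschitzWith.id.const_min T).const_max (-1)
  have h1 : LipschitzWith (A + B * 1)
      (Function.uncurry fun (x : Eu n) r => freeValue c g f U T x (max (-1) (min T r))) := by
    refine LipschitzWith.uncurry (fun r => LipschitzWith.of_le_add_mul A fun x y => ?_)
      (fun x => ?_)
    · rw [hA, dist_eq_norm]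
      linarith [h.freeValue_sub_le hU (hclamp r) x y]
    · have hx : LipschitzOnWith B (freeValue c g f U T x) (Icc (-1) T) := ?_
      · rw [← lipschitzOnWith_univ] at hlip1 ⊢
        exact hx.comp hlip1 fun r _ => hclamp r
      refine LipschitzOnWith.of_dist_le_mul fun s hs t ht => ?_
      rw [hB, Real.dist_eq]
      rcases le_total s t with hst | hst
      · rw [dist_comm, Real.dist_eq, abs_of_nonneg (sub_nonneg.2 hst)]
        exact h.abs_freeValue_sub_le_time hU hs.1 hst ht.2 x
      · rw [abs_sub_comm, Real.dist_eq, abs_of_nonneg (sub_nonneg.2 hst)]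
        exact h.abs_freeValue_sub_le_time hU ht.1 hst hs.2 x
  have h2 : LipschitzWith 1 (fun z : Eu n × ℝ => max (z.2 - T) 0) :=
    ((LipschitzWith.of_dist_le_mul (K := 1) fun a b : Eu n × ℝ => by
      simp [Prod.dist_eq] : LipschitzWith 1 fun z : Eu n × ℝ => z.2 - T)).max_const 0
  have h3 : LipschitzWith (K + K * K) (fun z : Eu n × ℝ => (K + K * K : ℝ) * max (z.2 - T) 0) := by
    refine LipschitzWith.of_dist_le_mul fun a b => ?_
    rw [Real.dist_eq, ← mul_sub, abs_mul, abs_of_nonneg (by positivity)]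
    push_cast
    gcongr
    simpa [Real.dist_eq] using h2.dist_le_mul a b
  exact ⟨_, h1.add h3⟩

theorem extendedValue_eq (ht : t ∈ Icc (-1) T) :
    extendedValue K c g f U T (x, t) = freeValue c g f U T x t := by
  simp [extendedValue, min_eq_right ht.2, max_eq_right ht.1, max_eq_right (sub_nonpos.2 ht.2)]

theorem extendedValue_of_le (h : IsBoundedLipschitzOCP K c g f) (hU : U.Nonempty) (hT : 0 < T)
    (ht : T ≤ t) : extendedValue K c g f U T (x, t) = g x + (K + K * K) * (t - T) := by
  simp [extendedValue, min_eq_left ht, max_eq_left (sub_nonneg.2 ht),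
    max_eq_right (show -1 ≤ T by linarith), h.freeValue_terminal hU]

theorem abs_extendedValue_le (h : IsBoundedLipschitzOCP K c g f) (hU : U.Nonempty) (hT : 0 < T)
    (z : Eu n × ℝ) (hz : z.2 ≤ T + 1) :
    |extendedValue K c g f U T z| ≤ K * (T + 1) + K + (K + K * K) := by
  have hK : (0 : ℝ) ≤ K := K.2
  refine (abs_add_le _ _).trans (add_le_add ?_ ?_)
  · refine (h.abs_freeValue_le hU (max_le (by linarith) (min_le_left _ _))).trans ?_
    gcongr
    linarith [le_max_left (-1) (min T z.2)]
  · rw [abs_of_nonneg (by positivity)]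
    exact mul_le_of_le_one_right (by positivity) (max_le (by linarith) zero_le_one)

/-- The dissipation inequality with a quadratic remainder: a trajectory with constant input `v`
is replaced by its tangent at `(x, t)`. -/
theorem exists_extendedValue_quasi_dissipation (h : IsBoundedLipschitzOCP K c g f)
    (hU : U.Nonempty) (hT : 0 < T) : ∃ C : ℝ, ∀ x : Eu n, ∀ v ∈ U, ∀ t, -1 ≤ t → ∃ δ > 0,
      ∀ r ∈ Ioo 0 δ, - c x v t * r - C * r ^ 2 ≤
        extendedValue K c g f U T ((x, t) + r • (f x v, 1)) - extendedValue K c g f U T (x, t) := by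
  have hK : (0 : ℝ) ≤ K := K.2
  set L := (K * (T + 1) + K) * Real.exp (K * (T + 1)) with hLdef
  have hL : 0 ≤ L := by positivity
  refine ⟨L * (K * K) + K * (K + 1), fun x v hv t ht => ?_⟩
  rcases lt_or_ge t T with htT | htT
  · refine ⟨T - t, sub_pos.2 htT, fun r hr => ?_⟩
    have hr0 : 0 < r := hr.1
    have hrT : t + r ≤ T := by linarith [hr.2]
    have htr : t ≤ t + r := by linarith
    obtain ⟨φ, hφ⟩ := h.exists_trajectory (u := fun _ => v) measurable_const htr x
    have hmove : ∀ s ∈ Icc t (t + r), ‖φ s - x‖ ≤ K * r := fun s hs => by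
      have := hφ.norm_sub_le h.bound_f le_rfl hs.1 hs.2
      rw [hφ.initial htr] at this
      exact this.trans (by gcongr; linarith [hs.2])
    have h1 := h.freeValue_le_integral_add hU htr hrT measurable_const (fun _ => hv) hφ
    have h2 := h.freeValue_sub_le hU (t := t + r) ⟨by linarith, hrT⟩ (φ (t + r)) (x + r • f x v)
    have h3 : ‖φ (t + r) - (x + r • f x v)‖ ≤ K * K * r ^ 2 := by
      have e1 : φ (t + r) - (x + r • f x v) = ∫ s in t..t + r, (f (φ s) v - f x v) := by
        have := hφ.sub_eq_integral le_rfl htr le_rfl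
        rw [hφ.initial htr] at this
        rw [intervalIntegral.integral_sub hφ.intervalIntegrable
          intervalIntegrable_const, ← this]
        simp only [intervalIntegral.integral_const, add_sub_cancel_left]
        abel
      rw [e1]
      refine (intervalIntegral.norm_integral_le_of_norm_le_const (C := K * (K * r))
        fun s hs => ?_).trans (le_of_eq ?_)
      · rw [uIoc_of_le htr] at hs
        have := h.lip_f.dist_le_mul (φ s, v) (x, v)
        rw [Prod.dist_eq, dist_self, max_eq_left dist_nonneg, dist_eq_norm, dist_eq_norm] at this
        exact this.trans (by gcongr; exact hmove s (Ioc_subset_Icc_self hs))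
      · rw [add_sub_cancel_left, abs_of_pos hr0]; ring
    have h4 : ∫ s in t..t + r, c (φ s) v s ≤ r * c x v t + K * (K + 1) * r ^ 2 := by
      have e1 : (∫ s in t..t + r, c (φ s) v s) - r * c x v t
          = ∫ s in t..t + r, (c (φ s) v s - c x v t) := by
        rw [intervalIntegral.integral_sub
          (h.intervalIntegrable_cost (u := fun _ => v) measurable_const hφ.continuousOn htr)
          intervalIntegrable_const]
        simp
      rw [← sub_le_iff_le_add', e1]
      refine (Real.le_norm_self _).trans ((intervalIntegral.norm_integral_le_of_norm_le_const
        (C := K * ((K + 1) * r)) fun s hs => ?_).trans (le_of_eq ?_))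
      · rw [uIoc_of_le htr] at hs
        have := h.lip_c.dist_le_mul (φ s, v, s) (x, v, t)
        refine this.trans ?_
        gcongr
        change max (dist (φ s) x) (max (dist v v) (dist s t)) ≤ _
        rw [dist_self, dist_eq_norm, Real.dist_eq, abs_of_pos (sub_pos.2 hs.1)]
        have h5 := hmove s (Ioc_subset_Icc_self hs)
        refine max_le (h5.trans (by nlinarith)) (max_le (by positivity) ?_)
        nlinarith [hs.2]
      · rw [add_sub_cancel_left, abs_of_pos hr0]; ring
    have e : (x, t) + r • (f x v, (1 : ℝ)) = (x + r • f x v, t + r) := by simp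
    rw [e, extendedValue_eq ⟨by linarith, hrT⟩, extendedValue_eq ⟨ht, htT.le⟩]
    have h6 := mul_le_mul_of_nonneg_left h3 hL
    rw [← hLdef] at h2
    nlinarith
  · refine ⟨1, one_pos, fun r hr => ?_⟩
    have hr0 : 0 < r := hr.1
    have e : (x, t) + r • (f x v, (1 : ℝ)) = (x + r • f x v, t + r) := by simp
    rw [e, h.extendedValue_of_le hU hT (by linarith), h.extendedValue_of_le hU hT htT]
    have h1 := h.lip_g.dist_le_mul x (x + r • f x v)
    rw [Real.dist_eq, dist_self_add_right, norm_smul, Real.norm_eq_abs, abs_of_pos hr0] at h1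
    have h2 : (K : ℝ) * (r * ‖f x v‖) ≤ K * (r * K) := by gcongr; exact h.bound_f x v
    have h3 := (abs_le.1 (h.bound_c x v t)).1
    have h4 := (abs_le.1 (h1.trans h2)).2
    have h5 : 0 ≤ (L * (K * K) + K * (K + 1)) * r ^ 2 := by positivity
    nlinarith

/-- The dissipation inequality for the line derivatives of the extended value function. -/
theorem neg_cost_le_of_hasLineDerivAt (h : IsBoundedLipschitzOCP K c g f) (hU : U.Nonempty)
    (hT : 0 < T) {v : Eu m} (hv : v ∈ U) (ht : -1 ≤ t) {d : ℝ}
    (hd : HasLineDerivAt ℝ (extendedValue K c g f U T) d (x, t) (f x v, 1)) :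
    - c x v t ≤ d := by
  obtain ⟨C, hC⟩ := h.exists_extendedValue_quasi_dissipation hU hT
  obtain ⟨δ, hδ, hδC⟩ := hC x v hv t ht
  have h1 := hd.tendsto_slope_zero_right
  have h2 : Filter.Tendsto (fun r : ℝ => - c x v t - C * r) (nhdsWithin 0 (Ioi 0))
      (nhds (- c x v t - C * 0)) :=
    Filter.Tendsto.mono_left (Continuous.tendsto (by fun_prop) 0) nhdsWithin_le_nhds
  rw [mul_zero, sub_zero] at h2
  refine le_of_tendsto_of_tendsto h2 h1 ?_
  filter_upwards [Ioo_mem_nhdsGT hδ] with r hr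
  have h3 := hδC r hr
  have hr0 : 0 < r := hr.1
  rw [smul_eq_mul, le_inv_mul_iff₀ hr0]
  calc _ = - c x v t * r - C * r ^ 2 := by ring
    _ ≤ _ := by simpa using h3

end IsBoundedLipschitzOCP

/-! ### Polynomials and convolutions on `ℝⁿ × ℝ` -/

instance isAddHaarMeasure_volume_prod_real (n : ℕ) :
    (volume : Measure (Eu n × ℝ)).IsAddHaarMeasure :=
  inferInstanceAs ((volume : Measure (Eu n)).prod (volume : Measure ℝ)).IsAddHaarMeasure

theorem contDiff_polyEval {n : ℕ} (P : MvPolynomial (Fin n ⊕ Unit) ℝ) :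
    ContDiff ℝ ∞ (fun z : Eu n × ℝ => polyEval P z.1 z.2) := by
  induction P using MvPolynomial.induction_on with
  | C a => simpa [polyEval] using contDiff_const
  | add p q hp hq => simpa [polyEval] using hp.add hq
  | mul_X p i hp =>
    have : ContDiff ℝ ∞ (fun z : Eu n × ℝ =>
        (Sum.elim (fun i => z.1 i) (fun _ => z.2) i : ℝ)) := by
      cases i with
      | inl i => simp only [Sum.elim_inl]; fun_prop
      | inr _ => simp only [Sum.elim_inr]; fun_prop
    simpa [polyEval] using hp.mul this

/-- The Stone–Weierstrass theorem for polynomials on a compact subset of `ℝⁿ × ℝ`. -/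
theorem exists_polyEval_near {n : ℕ} {S : Set (Eu n × ℝ)} (hS : IsCompact S)
    {h : Eu n × ℝ → ℝ} (hh : Continuous h) {ε : ℝ} (hε : 0 < ε) :
    ∃ P : MvPolynomial (Fin n ⊕ Unit) ℝ, ∀ z ∈ S, |polyEval P z.1 z.2 - h z| ≤ ε := by
  have : CompactSpace S := isCompact_iff_compactSpace.1 hS
  let F : Fin n ⊕ Unit → C(S, ℝ) := Sum.elim
    (fun i => ⟨fun z => z.1.1 i, by fun_prop⟩) (fun _ => ⟨fun z => z.1.2, by fun_prop⟩)
  have hF : ∀ (P : MvPolynomial (Fin n ⊕ Unit) ℝ) (z : S),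
      MvPolynomial.aeval F P z = polyEval P z.1.1 z.1.2 := by
    intro P z
    induction P using MvPolynomial.induction_on with
    | C a => simp [polyEval]
    | add p q hp hq => simpa [polyEval] using congrArg₂ (· + ·) hp hq
    | mul_X p i hp => cases i <;> simp [polyEval, F] at hp ⊢ <;> simp [hp]
  have hsep : (MvPolynomial.aeval F : _ →ₐ[ℝ] C(S, ℝ)).range.SeparatesPoints := by
    intro y z hyz
    by_contra hcon
    push Not at hcon
    have hX : ∀ i, F i y = F i z := fun i =>
      hcon (F i) ⟨F i, ⟨MvPolynomial.X i, by simp⟩, rfl⟩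
    refine hyz (Subtype.ext (Prod.ext ?_ (hX (Sum.inr ()))))
    ext i
    exact hX (Sum.inl i)
  obtain ⟨⟨_, P, rfl⟩, hP⟩ := ContinuousMap.exists_mem_subalgebra_near_continuous_of_separatesPoints
    _ hsep (fun z : S => h z) (hh.comp continuous_subtype_val) ε hε
  refine ⟨P, fun z hz => ?_⟩
  rw [← hF P ⟨z, hz⟩]
  exact (hP ⟨z, hz⟩).le

/-- Convolution with a polynomial kernel yields a polynomial. -/
theorem exists_polyEval_eq_integral {n : ℕ} {w : Eu n × ℝ → ℝ} (hw : Continuous w)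
    (hw' : HasCompactSupport w) (p : MvPolynomial (Fin n ⊕ Unit) ℝ) :
    ∃ Q : MvPolynomial (Fin n ⊕ Unit) ℝ, ∀ z : Eu n × ℝ,
      polyEval Q z.1 z.2 = ∫ y, w y * polyEval p (z - y).1 (z - y).2 := by
  -- `p(X - Y)` as a polynomial in `X` whose coefficients are polynomials in `Y`
  let q : MvPolynomial (Fin n ⊕ Unit) (MvPolynomial (Fin n ⊕ Unit) ℝ) :=
    MvPolynomial.aeval (fun i => MvPolynomial.X i - MvPolynomial.C (MvPolynomial.X i)) p
  let co : Eu n × ℝ → Fin n ⊕ Unit → ℝ := fun z => Sum.elim (fun i => z.1 i) (fun _ => z.2)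
  have hq : ∀ z y : Eu n × ℝ, polyEval p (z - y).1 (z - y).2 =
      ∑ m ∈ q.support, polyEval (q.coeff m) y.1 y.2 * ∏ i, co z i ^ m i := by
    intro z y
    have h1 : polyEval p (z - y).1 (z - y).2 =
        MvPolynomial.eval₂ (MvPolynomial.eval (co y)) (co z) q := by
      simp only [q]
      generalize p = p'
      induction p' using MvPolynomial.induction_on with
      | C a => simp [polyEval, MvPolynomial.algebraMap_eq,
          IsScalarTower.algebraMap_apply ℝ (MvPolynomial (Fin n ⊕ Unit) ℝ)
            (MvPolynomial (Fin n ⊕ Unit) (MvPolynomial (Fin n ⊕ Unit) ℝ))]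
      | add p q hp hq => simpa [polyEval] using congrArg₂ (· + ·) hp hq
      | mul_X p i hp =>
        cases i <;> simp [polyEval, co] at hp ⊢ <;> simp [hp]
    rw [h1, MvPolynomial.eval₂_eq']
    rfl
  refine ⟨∑ m ∈ q.support, MvPolynomial.monomial m (∫ y, w y * polyEval (q.coeff m) y.1 y.2),
    fun z => ?_⟩
  simp_rw [hq, Finset.mul_sum]
  rw [integral_finsetSum]
  · simp only [polyEval, map_sum, MvPolynomial.eval_monomial]
    refine Finset.sum_congr rfl fun m _ => ?_
    rw [Finsupp.prod_fintype _ _ (by simp), ← integral_mul_const]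
    simp only [mul_assoc]
    rfl
  · intro m _
    simp_rw [← mul_assoc]
    refine Integrable.mul_const ?_ _
    exact (hw.mul (contDiff_polyEval _).continuous).integrable_of_hasCompactSupport hw'.mul_right

theorem lineDeriv_eq_zero_of_lt_norm {E : Type*} [NormedAddCommGroup E] [NormedSpace ℝ E]
    {w : E → ℝ} {R : ℝ} (h0 : ∀ z, R < ‖z‖ → w z = 0) (v z : E) (hz : R < ‖z‖) :
    lineDeriv ℝ w z v = 0 := by
  have : w =ᶠ[nhds z] fun _ => 0 := by
    filter_upwards [(isOpen_lt continuous_const continuous_norm).mem_nhds hz] with y hy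
    exact h0 y hy
  rw [this.lineDeriv_eq]; simp [lineDeriv]

section Convolution

variable {E : Type*} [NormedAddCommGroup E] [NormedSpace ℝ E] [FiniteDimensional ℝ E]
  [MeasurableSpace E] [BorelSpace E] {μ : Measure E} [μ.IsAddHaarMeasure]
  {w : E → ℝ} {L : ℝ≥0} {R M : ℝ}

theorem integrable_comp_sub_mul {b k : E → ℝ} (hb : Measurable b) (hM : ∀ z, |b z| ≤ M)
    (h0 : ∀ z, R < ‖z‖ → b z = 0) (hk : Continuous k) (z : E) :
    Integrable (fun y => b (z - y) * k y) μ := by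
  have hi : IntegrableOn (fun y => M * k y) (Metric.closedBall 0 (‖z‖ + R)) μ :=
    ((continuous_const.mul hk).continuousOn).integrableOn_compact (isCompact_closedBall _ _)
  have hm : AEStronglyMeasurable (fun y => b (z - y) * k y) μ :=
    ((hb.comp (measurable_const.sub measurable_id)).mul hk.measurable).aestronglyMeasurable
  rw [← integrableOn_iff_integrable_of_support_subset (s := Metric.closedBall 0 (‖z‖ + R))]
  · refine Integrable.mono hi hm.restrict (ae_of_all _ fun y => ?_)
    rw [norm_mul, norm_mul]
    gcongr
    exact (hM _).trans (le_abs_self M)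
  · intro y hy
    by_contra hy'
    refine hy ?_
    rw [mem_closedBall_zero_iff, not_le] at hy'
    have : R < ‖z - y‖ := by
      have := norm_sub_norm_le y z
      rw [norm_sub_rev] at this
      linarith
    simp [h0 _ this]

/-- The line derivatives of the convolution of a Lipschitz function with a continuous kernel fall
on the Lipschitz function, which is differentiable along almost every line. -/
theorem hasLineDerivAt_integral_comp_sub_mul (hw : LipschitzWith L w)
    (h0 : ∀ z, R < ‖z‖ → w z = 0) (hM : ∀ z, |w z| ≤ M) {k : E → ℝ} (hk : Continuous k)
    (z v : E) :
    HasLineDerivAt ℝ (fun z => ∫ y, w (z - y) * k y ∂μ)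
      (∫ y, lineDeriv ℝ w (z - y) v * k y ∂μ) z v := by
  set B := Metric.closedBall (0 : E) (‖z‖ + ‖v‖ + R)
  have hd : Measurable fun y => lineDeriv ℝ w y v := measurable_lineDeriv hw.continuous
  refine (hasDerivAt_integral_of_dominated_loc_of_lip (F := fun r y => w (z + r • v - y) * k y)
    (bound := B.indicator fun y => L * ‖v‖ * |k y|) (s := Metric.ball 0 1)
    (Metric.ball_mem_nhds 0 one_pos) ?_ ?_ ?_ ?_ ?_ ?_).2
  · exact Filter.Eventually.of_forall fun r =>
      (integrable_comp_sub_mul hw.continuous.measurable hM h0 hk _).aestronglyMeasurable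
  · exact integrable_comp_sub_mul hw.continuous.measurable hM h0 hk _
  · exact ((hd.comp (measurable_const.sub measurable_id)).mul hk.measurable).aestronglyMeasurable
  · refine ae_of_all _ fun y => LipschitzOnWith.of_dist_le_mul fun r hr r' hr' => ?_
    by_cases hy : y ∈ B
    · rw [indicator_of_mem hy, Real.coe_nnabs, abs_of_nonneg (by positivity), Real.dist_eq,
        ← sub_mul, abs_mul]
      have h1 := hw.dist_le_mul (z + r • v - y) (z + r' • v - y)
      rw [dist_sub_right, dist_add_left, dist_eq_norm (r • v), ← sub_smul, norm_smul,
        Real.dist_eq] at h1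
      calc _ ≤ L * (‖r - r'‖ * ‖v‖) * |k y| := by gcongr
        _ = _ := by rw [dist_eq_norm]; ring
    · -- for `y` outside the large ball `B` the integrand vanishes along the whole segment
      have hz : ∀ q ∈ Metric.ball (0 : ℝ) 1, w (z + q • v - y) = 0 := by
        intro q hq
        apply h0
        rw [mem_closedBall_zero_iff, not_le] at hy
        rw [mem_ball_zero_iff] at hq
        have h1 := norm_sub_norm_le y (z + q • v)
        rw [norm_sub_rev] at h1
        have h2 := norm_add_le z (q • v)
        rw [norm_smul] at h2
        nlinarith [norm_nonneg v]
      simp only [hz r hr, hz r' hr', zero_mul, dist_self]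
      positivity
  · rw [integrable_indicator_iff Metric.isClosed_closedBall.measurableSet]
    exact (Continuous.continuousOn (by fun_prop)).integrableOn_compact (isCompact_closedBall _ _)
  · have h1 := (quasiMeasurePreserving_sub_left μ z).ae (hw.ae_lineDifferentiableAt (μ := μ) v)
    filter_upwards [h1] with y hy
    have h2 : HasDerivAt (fun r : ℝ => w (z - y + r • v)) (lineDeriv ℝ w (z - y) v) 0 :=
      hy.hasLineDerivAt
    simpa only [sub_add_eq_add_sub] using h2.mul_const (k y)

/-- For functions supported in a ball, uniformly close kernels give uniformly close
convolutions on that ball. -/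
theorem abs_integral_comp_sub_mul_sub_le {b k k' : E → ℝ} (hb : Measurable b)
    (hM : ∀ z, |b z| ≤ M) (h0 : ∀ z, R < ‖z‖ → b z = 0) (hk : Continuous k)
    (hk' : Continuous k') {η : ℝ} (hη : ∀ y ∈ Metric.closedBall (0 : E) (2 * R), |k y - k' y| ≤ η)
    {z : E} (hz : ‖z‖ ≤ R) :
    |(∫ y, b (z - y) * k y ∂μ) - ∫ y, b (z - y) * k' y ∂μ|
      ≤ M * η * μ.real (Metric.closedBall 0 (2 * R)) := by
  have hM0 : 0 ≤ M := (abs_nonneg _).trans (hM 0)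
  rw [← integral_sub (integrable_comp_sub_mul hb hM h0 hk z)
    (integrable_comp_sub_mul hb hM h0 hk' z)]
  have hzero : ∀ y, y ∉ Metric.closedBall (0 : E) (2 * R) →
      b (z - y) * k y - b (z - y) * k' y = 0 := by
    intro y hy
    rw [mem_closedBall_zero_iff, not_le] at hy
    have h1 := norm_sub_norm_le y z
    rw [norm_sub_rev] at h1
    rw [h0 _ (by linarith), zero_mul, zero_mul, sub_zero]
  rw [← setIntegral_eq_integral_of_forall_compl_eq_zero hzero, ← Real.norm_eq_abs]
  refine norm_setIntegral_le_of_norm_le_const (isCompact_closedBall _ _).measure_lt_top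
    fun y hy => ?_
  rw [← mul_sub, norm_mul]
  exact mul_le_mul (hM _) (hη y hy) (norm_nonneg _) hM0

end Convolution

/-! ### Polynomial approximation of Lipschitz functions -/

/-- Polynomials approximating a Lipschitz function `w` that is supported in a ball: they converge
uniformly on the ball, their line derivatives converge almost everywhere there and stay bounded,
and lower bounds for a line derivative of `w` near a point pass to the polynomials. They are the
convolutions of `w` with polynomials that are uniformly close to mollifiers. -/
theorem exists_polyEval_approx_lipschitz {n : ℕ} {w : Eu n × ℝ → ℝ} {L : ℝ≥0} {R M : ℝ}
    (hw : LipschitzWith L w) (hM : ∀ z, |w z| ≤ M) (h0 : ∀ z, R < ‖z‖ → w z = 0) :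
    ∃ (P : ℕ → MvPolynomial (Fin n ⊕ Unit) ℝ) (C : ℝ), 0 ≤ C ∧
      (∀ k z, ‖z‖ ≤ R → |polyEval (P k) z.1 z.2 - w z| ≤ C / (k + 1)) ∧
      (∀ v, ∀ᵐ z, ‖z‖ ≤ R → Filter.Tendsto
        (fun k => lineDeriv ℝ (fun z : Eu n × ℝ => polyEval (P k) z.1 z.2) z v) Filter.atTop
        (nhds (lineDeriv ℝ w z v))) ∧
      (∀ v k z, ‖z‖ ≤ R →
        |lineDeriv ℝ (fun z : Eu n × ℝ => polyEval (P k) z.1 z.2) z v| ≤ (L + C) * ‖v‖) ∧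
      (∀ v (k : ℕ) z a, ‖z‖ ≤ R → (∀ᵐ y, dist y z < 1 / (k + 1) → a ≤ lineDeriv ℝ w y v) →
        a - C * ‖v‖ / (k + 1)
          ≤ lineDeriv ℝ (fun z : Eu n × ℝ => polyEval (P k) z.1 z.2) z v) := by
  have hM0 : 0 ≤ M := (abs_nonneg _).trans (hM 0)
  have hL0 : (0 : ℝ) ≤ L := L.2
  have hk0 : ∀ k : ℕ, (0 : ℝ) < k + 1 := fun k => by positivity
  have hcs : HasCompactSupport w :=
    HasCompactSupport.intro (isCompact_closedBall 0 R) fun z hz => h0 z (by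
      rwa [mem_closedBall_zero_iff, not_le] at hz)
  -- mollifiers `ρ k` supported in the ball of radius `1 / (k + 1)`
  let φ : ℕ → ContDiffBump (0 : Eu n × ℝ) := fun k =>
    ⟨1 / (k + 1) / 2, 1 / (k + 1), by have := hk0 k; positivity,
      half_lt_self (by have := hk0 k; positivity)⟩
  set ρ : ℕ → Eu n × ℝ → ℝ := fun k => (φ k).normed volume with hρdef
  have hρc : ∀ k, Continuous (ρ k) := fun k => (φ k).continuous_normed
  have hρ0 : ∀ k y, 0 ≤ ρ k y := fun k y => (φ k).nonneg_normed y
  have hρ1 : ∀ k, ∫ y, ρ k y = 1 := fun k => (φ k).integral_normed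
  have hρi : ∀ k, Integrable (ρ k) := fun k => (φ k).integrable_normed
  have hρs : ∀ (k : ℕ) y, 1 / ((k : ℝ) + 1) ≤ ‖y‖ → ρ k y = 0 := fun k y hy => by
    have : y ∉ Function.support (ρ k) := by
      rw [hρdef, (φ k).support_normed_eq, mem_ball_zero_iff, not_lt]; exact hy
    simpa using this
  -- `‖z‖ ≤ R` and `‖z - y‖ ≤ R` force `‖y‖ ≤ 2 * R`, so kernels only matter on that ball
  choose p hp using fun k : ℕ => exists_polyEval_near
    (isCompact_closedBall (0 : Eu n × ℝ) (2 * R)) (hρc k) (one_div_pos.2 (hk0 k))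
  have hpc : ∀ k, Continuous fun z : Eu n × ℝ => polyEval (p k) z.1 z.2 := fun k =>
    (contDiff_polyEval _).continuous
  choose P hP using fun k => exists_polyEval_eq_integral hw.continuous hcs (p k)
  set b : ℝ := volume.real (Metric.closedBall (0 : Eu n × ℝ) (2 * R)) with hb
  have hb0 : 0 ≤ b := measureReal_nonneg
  have hPeq : ∀ k, (fun z : Eu n × ℝ => polyEval (P k) z.1 z.2)
      = fun z => ∫ y, w (z - y) * polyEval (p k) y.1 y.2 := by
    intro k
    funext z
    rw [hP, ← integral_sub_left_eq_self _ _ z]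
    simp
  have hPd : ∀ k z v, lineDeriv ℝ (fun z : Eu n × ℝ => polyEval (P k) z.1 z.2) z v
      = ∫ y, lineDeriv ℝ w (z - y) v * polyEval (p k) y.1 y.2 := by
    intro k z v
    rw [hPeq]
    exact (hasLineDerivAt_integral_comp_sub_mul hw h0 hM (hpc k) z v).lineDeriv
  have hdm : ∀ v, Measurable fun y => lineDeriv ℝ w y v := fun v =>
    measurable_lineDeriv hw.continuous
  have hdb : ∀ v z, |lineDeriv ℝ w z v| ≤ L * ‖v‖ := fun v z =>
    norm_lineDeriv_le_of_lipschitz ℝ hw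
  have hd0 : ∀ v z, R < ‖z‖ → lineDeriv ℝ w z v = 0 := fun v z hz =>
    lineDeriv_eq_zero_of_lt_norm h0 v z hz
  have hclose : ∀ k z v, ‖z‖ ≤ R → |lineDeriv ℝ (fun z : Eu n × ℝ => polyEval (P k) z.1 z.2) z v
      - ∫ y, lineDeriv ℝ w (z - y) v * ρ k y| ≤ L * b * ‖v‖ / (k + 1) := by
    intro k z v hz
    rw [hPd]
    refine (abs_integral_comp_sub_mul_sub_le (hdm v) (hdb v) (hd0 v) (hpc k) (hρc k) (hp k)
      hz).trans (le_of_eq ?_)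
    rw [← hb]; ring
  have hmi : ∀ k z v, Integrable fun y => lineDeriv ℝ w (z - y) v * ρ k y := fun k z v =>
    integrable_comp_sub_mul (hdm v) (hdb v) (hd0 v) (hρc k) z
  have hCle : ∀ (k : ℕ) (v : Eu n × ℝ),
      L * b * ‖v‖ / (k + 1) ≤ (M * b + L * b + L) * ‖v‖ / (k + 1) :=
    fun k v => by
      have := hk0 k
      gcongr
      nlinarith [mul_nonneg hM0 hb0]
  refine ⟨P, M * b + L * b + L, by positivity, ?_, ?_, ?_, ?_⟩
  · intro k z hz
    have h1 := abs_integral_comp_sub_mul_sub_le (μ := volume) hw.continuous.measurable hM h0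
      (hpc k) (hρc k) (hp k) hz
    have h2 : |(∫ y, w (z - y) * ρ k y) - w z| ≤ L * (1 / (k + 1)) := by
      have e : (∫ y, w (z - y) * ρ k y) - w z = ∫ y, (w (z - y) - w z) * ρ k y := by
        simp_rw [sub_mul]
        rw [integral_sub (integrable_comp_sub_mul hw.continuous.measurable hM h0 (hρc k) z)
          ((hρi k).const_mul _), integral_const_mul, hρ1, mul_one]
      rw [e]
      calc _ ≤ ∫ y, L * (1 / (k + 1)) * ρ k y := by
            refine (Real.norm_eq_abs _).symm.trans_le <|
              norm_integral_le_of_norm_le ((hρi k).const_mul _) (ae_of_all _ fun y => ?_)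
            rw [norm_mul, Real.norm_of_nonneg (hρ0 k y)]
            rcases le_or_gt (1 / ((k : ℝ) + 1)) ‖y‖ with hy | hy
            · simp [hρs k y hy]
            · have := hw.dist_le_mul (z - y) z
              rw [dist_eq_norm, dist_self_sub_left] at this
              have h3 := hρ0 k y
              gcongr
              exact this.trans (by gcongr)
        _ = _ := by rw [integral_const_mul, hρ1, mul_one]
    have h3 : polyEval (P k) z.1 z.2 = ∫ y, w (z - y) * polyEval (p k) y.1 y.2 :=
      congrFun (hPeq k) z
    rw [h3]
    calc _ ≤ _ := abs_sub_le _ (∫ y, w (z - y) * ρ k y) _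
      _ ≤ M * (1 / (k + 1)) * b + L * (1 / (k + 1)) := add_le_add h1 h2
      _ = (M * b + L) / (k + 1) := by ring
      _ ≤ _ := by
        have := hk0 k
        gcongr
        nlinarith [mul_nonneg hL0 hb0]
  · intro v
    have hli : LocallyIntegrable (fun y => lineDeriv ℝ w y v) volume :=
      hw.locallyIntegrable_lineDeriv v
    have h1 := ContDiffBump.ae_convolution_tendsto_right_of_locallyIntegrable (φ := φ) (K := 2)
      (l := Filter.atTop) (μ := volume) tendsto_one_div_add_atTop_nhds_zero_nat
      (Filter.Eventually.of_forall fun k => le_of_eq (by simp only [φ]; ring)) hli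
    filter_upwards [h1] with z hz hzR
    have h2 : Filter.Tendsto (fun k : ℕ => L * b * ‖v‖ / ((k : ℝ) + 1)) Filter.atTop (nhds 0) := by
      simpa [div_eq_mul_inv] using
        (tendsto_one_div_add_atTop_nhds_zero_nat (𝕜 := ℝ)).const_mul (L * b * ‖v‖)
    have h3 := squeeze_zero_norm
      (fun k => (Real.norm_eq_abs _).trans_le (hclose k z v hzR)) h2
    have h4 := h3.add hz
    rw [zero_add] at h4
    refine h4.congr fun k => ?_
    have : (convolution ((φ k).normed volume) (fun y => lineDeriv ℝ w y v)
        (ContinuousLinearMap.lsmul ℝ ℝ) volume) z = ∫ y, lineDeriv ℝ w (z - y) v * ρ k y := by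
      simp only [convolution, ContinuousLinearMap.lsmul_apply, smul_eq_mul]
      exact integral_congr_ae (ae_of_all _ fun y => mul_comm _ _)
    rw [this, sub_add_cancel]
  · intro v k z hz
    have h1 := hclose k z v hz
    have h2 : |∫ y, lineDeriv ℝ w (z - y) v * ρ k y| ≤ L * ‖v‖ := by
      calc _ ≤ ∫ y, L * ‖v‖ * ρ k y := by
            refine (Real.norm_eq_abs _).symm.trans_le <|
              norm_integral_le_of_norm_le ((hρi k).const_mul _) (ae_of_all _ fun y => ?_)
            rw [norm_mul, Real.norm_of_nonneg (hρ0 k y)]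
            have := hρ0 k y
            gcongr
            exact hdb v _
        _ = _ := by rw [integral_const_mul, hρ1, mul_one]
    have h3 : (M * b + L * b + L) * ‖v‖ / (k + 1) ≤ (M * b + L * b + L) * ‖v‖ :=
      div_le_self (by positivity) (by linarith [(Nat.cast_nonneg k : (0 : ℝ) ≤ k)])
    have h4 := hCle k v
    have h5 := abs_sub_abs_le_abs_sub
      (lineDeriv ℝ (fun z : Eu n × ℝ => polyEval (P k) z.1 z.2) z v)
      (∫ y, lineDeriv ℝ w (z - y) v * ρ k y)
    rw [add_mul]
    linarith
  · intro v k z a hz ha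
    have h1 := (abs_le.1 (hclose k z v hz)).1
    have h2 : a ≤ ∫ y, lineDeriv ℝ w (z - y) v * ρ k y := by
      calc a = ∫ y, a * ρ k y := by rw [integral_const_mul, hρ1, mul_one]
        _ ≤ _ := by
          refine integral_mono_ae ((hρi k).const_mul _) (hmi k z v) ?_
          filter_upwards [(quasiMeasurePreserving_sub_left volume z).ae ha] with y hy
          rcases le_or_gt (1 / ((k : ℝ) + 1)) ‖y‖ with hy' | hy'
          · simp [hρs k y hy']
          · exact mul_le_mul_of_nonneg_right (hy (by rwa [dist_self_sub_left])) (hρ0 k y)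
    have h4 := hCle k v
    linarith

/-! ### Extension of the data, weak derivatives and Sobolev norms -/

theorem exists_bounded_lipschitz_extension {X : Type*} [PseudoMetricSpace X] {S : Set X}
    (hS : IsCompact S) {h : X → ℝ} {L : ℝ≥0} (hL : LipschitzOnWith L h S) :
    ∃ (h' : X → ℝ) (M : ℝ≥0), LipschitzWith L h' ∧ EqOn h' h S ∧ ∀ x, |h' x| ≤ M := by
  obtain ⟨q, hq, hqS⟩ := hL.extend_real
  obtain ⟨M, hM⟩ := hS.exists_bound_of_continuousOn hL.continuousOn
  let N : ℝ≥0 := Real.toNNReal M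
  refine ⟨fun x => max (-N) (min N (q x)), N, (hq.const_min _).const_max _, fun x hx => ?_,
    fun x => abs_le.2 ⟨le_max_left _ _, max_le (by linarith [N.2]) (min_le_left _ _)⟩⟩
  have h1 := abs_le.1 ((hM x hx).trans (Real.le_coe_toNNReal M))
  simp only [← hqS hx]
  rw [min_eq_right h1.2, max_eq_right h1.1]

theorem exists_bounded_lipschitz_extension_euclidean {X : Type*} [PseudoMetricSpace X] {n : ℕ}
    {S : Set X} (hS : IsCompact S) {h : X → Eu n} {L : ℝ≥0} (hL : LipschitzOnWith L h S) :
    ∃ (h' : X → Eu n) (L' M : ℝ≥0), LipschitzWith L' h' ∧ EqOn h' h S ∧ ∀ x, ‖h' x‖ ≤ M := by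
  have hcomp : ∀ i, LipschitzOnWith L (fun x => h x i) S := fun i =>
    LipschitzOnWith.of_dist_le_mul fun x hx y hy =>
      (PiLp.dist_apply_le (h x) (h y) i).trans (hL.dist_le_mul x hx y hy)
  choose q M hq hqS hqM using fun i => exists_bounded_lipschitz_extension hS (hcomp i)
  have hpi : LipschitzWith L (fun x i => q i x) :=
    LipschitzWith.of_dist_le_mul fun x y =>
      (dist_pi_le_iff (by positivity)).2 fun i => (hq i).dist_le_mul x y
  have hto := PiLp.lipschitzWith_toLp 2 (fun _ : Fin n => ℝ)
  refine ⟨fun x => WithLp.toLp 2 fun i => q i x, _,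
    (Fintype.card (Fin n) : ℝ≥0) ^ (1 / 2 : ℝ≥0∞).toReal * ∑ i, M i, hto.comp hpi,
    fun x hx => ?_, fun x => ?_⟩
  · ext i
    exact hqS i hx
  · have h1 := hto.dist_le_mul (fun i => q i x) 0
    rw [WithLp.toLp_zero, dist_zero_right, dist_zero_right] at h1
    have h2 : ‖fun i => q i x‖ ≤ ((∑ i, M i : ℝ≥0) : ℝ) :=
      (pi_norm_le_iff_of_nonneg (NNReal.coe_nonneg _)).2 fun i =>
        (hqM i x).trans (NNReal.coe_le_coe.2
          (Finset.single_le_sum (fun _ _ => zero_le) (Finset.mem_univ i)))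
    exact h1.trans ((mul_le_mul_of_nonneg_left h2 (NNReal.coe_nonneg _)).trans_eq
      (NNReal.coe_mul _ _).symm)

/-- Locally Lipschitz data on compact sets extend to bounded, globally Lipschitz data. -/
theorem exists_isBoundedLipschitzOCP {n m : ℕ} {c : Eu n → Eu m → ℝ → ℝ} {g : Eu n → ℝ}
    {f : Eu n → Eu m → Eu n} {Ω : Set (Eu n)} {U : Set (Eu m)} {T : ℝ}
    (hOCP : IsLipschitzOCP c g f Ω U T) (hΩ : IsCompact Ω)
    (hf : LocLip (univ ×ˢ U) (fun z : Eu n × Eu m => f z.1 z.2)) {B : Set (Eu n)}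
    (hB : IsCompact B) :
    ∃ (K : ℝ≥0) (c' : Eu n → Eu m → ℝ → ℝ) (g' : Eu n → ℝ) (f' : Eu n → Eu m → Eu n),
      IsBoundedLipschitzOCP K c' g' f' ∧
      (∀ x ∈ Ω, ∀ v ∈ U, ∀ t ∈ Icc 0 T, c' x v t = c x v t) ∧ (∀ x ∈ Ω, g' x = g x) ∧
      (∀ x ∈ B, ∀ v ∈ U, f' x v = f x v) := by
  have hU := hOCP.isCompact_U
  have hcS : IsCompact (Ω ×ˢ U ×ˢ Icc 0 T) := hΩ.prod (hU.prod isCompact_Icc)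
  have hfS : IsCompact (B ×ˢ U) := hB.prod hU
  obtain ⟨Lc, hLc⟩ := hOCP.locLip_c _ Subset.rfl hcS
  obtain ⟨Lg, hLg⟩ := hOCP.locLip_g _ Subset.rfl hΩ
  obtain ⟨Lf, hLf⟩ := hf _ (prod_mono (subset_univ _) Subset.rfl) hfS
  obtain ⟨c', Mc, hc1, hc2, hc3⟩ := exists_bounded_lipschitz_extension hcS hLc
  obtain ⟨g', Mg, hg1, hg2, hg3⟩ := exists_bounded_lipschitz_extension hΩ hLg
  obtain ⟨f', Lf', Mf, hf1, hf2, hf3⟩ := exists_bounded_lipschitz_extension_euclidean hfS hLf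
  let K : ℝ≥0 := max (max Lc Mc) (max (max Lg Mg) (max Lf' Mf))
  refine ⟨K, fun x v t => c' (x, v, t), g', fun x v => f' (x, v), ⟨?_, ?_, ?_, ?_, ?_, ?_⟩,
    fun x hx v hv t ht => hc2 ⟨hx, hv, ht⟩, fun x hx => hg2 hx, fun x hx v hv => hf2 ⟨hx, hv⟩⟩
  · exact hc1.weaken (by simp [K])
  · exact hg1.weaken (by simp [K])
  · exact hf1.weaken (by simp [K])
  · exact fun x v s => (hc3 _).trans (NNReal.coe_le_coe.2 (by simp [K]))
  · exact fun x => (hg3 _).trans (NNReal.coe_le_coe.2 (by simp [K]))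
  · exact fun x v => (hf3 _).trans (NNReal.coe_le_coe.2 (by simp [K]))

/-- Lipschitz truncation to a ball, by clamping between `± M * (R - ‖z‖)⁺`. -/
theorem exists_lipschitz_truncation {E : Type*} [SeminormedAddCommGroup E] {W : E → ℝ} {L M : ℝ≥0}
    (hW : LipschitzWith L W) {R : ℝ} (hR : 0 ≤ R) :
    ∃ (w : E → ℝ) (L' : ℝ≥0), LipschitzWith L' w ∧ (∀ z, |w z| ≤ M * R) ∧
      (∀ z, R < ‖z‖ → w z = 0) ∧ (∀ z, ‖z‖ ≤ R - 1 → |W z| ≤ M → w z = W z) := by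
  let β : E → ℝ := fun z => M * max (R - ‖z‖) 0
  have hβ0 : ∀ z, 0 ≤ β z := fun z => by positivity
  have hβ : LipschitzWith M β := by
    refine LipschitzWith.of_dist_le_mul fun x y => ?_
    rw [Real.dist_eq, ← mul_sub, abs_mul, NNReal.abs_eq]
    gcongr
    have h1 : LipschitzWith 1 fun z : E => max (R - ‖z‖) 0 :=
      (LipschitzWith.of_dist_le_mul fun a b => by
        rw [dist_sub_left, NNReal.coe_one, one_mul]
        exact (dist_norm_norm_le a b).trans_eq (dist_eq_norm a b).symm :
          LipschitzWith 1 fun z : E => R - ‖z‖).max_const 0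
    simpa [Real.dist_eq] using h1.dist_le_mul x y
  refine ⟨fun z => max (-β z) (min (β z) (W z)), _, hβ.neg.max (hβ.min hW), fun z => ?_,
    fun z hz => ?_, fun z hz hM => ?_⟩
  · refine (abs_le.2 ⟨le_max_left _ _, max_le ?_ (min_le_left _ _)⟩ : _ ≤ β z).trans ?_
    · linarith [hβ0 z]
    · simp only [β]
      gcongr
      exact max_le (by linarith [norm_nonneg z]) hR
  · have : β z = 0 := by simp [β, max_eq_right (sub_nonpos.2 hz.le)]
    simp [this]
  · have h1 : (M : ℝ) ≤ β z := le_mul_of_one_le_right M.2 (le_max_of_le_left (by linarith))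
    have h2 := abs_le.1 (hM.trans h1)
    change max (-β z) (min (β z) (W z)) = W z
    rw [min_eq_right h2.2, max_eq_right h2.1]

section WeakDerivative

variable {n : ℕ} {v : Eu n × ℝ} {F G H H' : Eu n × ℝ → ℝ}

theorem isWeakDeriv_univ_of_lipschitzWith {L : ℝ≥0} (hF : LipschitzWith L F) (v : Eu n × ℝ) :
    IsWeakDeriv univ v F (fun z => lineDeriv ℝ F z v) where
  locallyIntegrableOn := locallyIntegrableOn_univ.2 hF.continuous.locallyIntegrable
  locallyIntegrableOn_deriv := locallyIntegrableOn_univ.2 (hF.locallyIntegrable_lineDeriv v)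
  integral_eq α hα hα' _ := by
    obtain ⟨D, hD⟩ := hα.lipschitzWith_of_hasCompactSupport hα' (by simp)
    have hd : ∀ z, fderiv ℝ α z v = - lineDeriv ℝ α z (-v) := fun z => by
      rw [((hα.differentiable (by simp)) z).lineDeriv_eq_fderiv, map_neg, neg_neg]
    simp only [Measure.restrict_univ]
    rw [hF.integral_lineDeriv_mul_eq hD hα' v, ← integral_neg]
    refine integral_congr_ae (ae_of_all _ fun z => ?_)
    simp only [hd]
    ring

theorem isWeakDeriv_univ_of_contDiff (hF : ContDiff ℝ ∞ F) (v : Eu n × ℝ) :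
    IsWeakDeriv univ v F (fun z => lineDeriv ℝ F z v) := by
  have hd : (fun z => lineDeriv ℝ F z v) = fun z => fderiv ℝ F z v := by
    funext z
    exact ((hF.differentiable (by simp)) z).lineDeriv_eq_fderiv
  have hc : Continuous fun z => fderiv ℝ F z v :=
    (hF.continuous_fderiv (by simp)).clm_apply continuous_const
  rw [hd]
  refine ⟨locallyIntegrableOn_univ.2 hF.continuous.locallyIntegrable,
    locallyIntegrableOn_univ.2 hc.locallyIntegrable, fun α hα hα' _ => ?_⟩
  have hαc : Continuous fun z => fderiv ℝ α z v :=
    (hα.continuous_fderiv (by simp)).clm_apply continuous_const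
  simp only [Measure.restrict_univ]
  exact integral_mul_fderiv_eq_neg_fderiv_mul_of_integrable
    ((hc.mul hα.continuous).integrable_of_hasCompactSupport hα'.mul_left)
    ((hF.continuous.mul hαc).integrable_of_hasCompactSupport
      ((hα'.fderiv_apply (𝕜 := ℝ) v).mul_left))
    ((hF.continuous.mul hα.continuous).integrable_of_hasCompactSupport hα'.mul_left)
    (fun z _ => hF.differentiable (by simp) z) (fun z _ => hα.differentiable (by simp) z)

theorem IsWeakDeriv.sub_univ (h : IsWeakDeriv univ v F H) (h' : IsWeakDeriv univ v G H') :
    IsWeakDeriv univ v (fun z => F z - G z) (fun z => H z - H' z) where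
  locallyIntegrableOn := h.locallyIntegrableOn.sub h'.locallyIntegrableOn
  locallyIntegrableOn_deriv := h.locallyIntegrableOn_deriv.sub h'.locallyIntegrableOn_deriv
  integral_eq α hα hα' hα'' := by
    have hαc : Continuous fun z => fderiv ℝ α z v :=
      (hα.continuous_fderiv (by simp)).clm_apply continuous_const
    have hi : ∀ {Q β : Eu n × ℝ → ℝ}, LocallyIntegrableOn Q univ volume → Continuous β →
        HasCompactSupport β → Integrable (fun z => Q z * β z) := fun {Q β} hQ hβ hβ' => by
      simpa [mul_comm] using
        (locallyIntegrableOn_univ.1 hQ).integrable_smul_left_of_hasCompactSupport hβ hβ'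
    have h1 := h.integral_eq α hα hα' hα''
    have h2 := h'.integral_eq α hα hα' hα''
    simp only [Measure.restrict_univ] at h1 h2 ⊢
    have hα1 := hα'.fderiv_apply (𝕜 := ℝ) v
    simp_rw [sub_mul]
    rw [integral_sub (hi h.locallyIntegrableOn hαc hα1) (hi h'.locallyIntegrableOn hαc hα1),
      integral_sub (hi h.locallyIntegrableOn_deriv hα.continuous hα')
        (hi h'.locallyIntegrableOn_deriv hα.continuous hα'), h1, h2]
    ring

/-- A function that is Lipschitz up to a smooth summand has its line derivatives as weak
derivatives, which bounds its Sobolev norm on any set. -/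
theorem sobolevNorm_sub_le {L : ℝ≥0} (hF : LipschitzWith L F) (hG : ContDiff ℝ ∞ G)
    {A : Set (Eu n × ℝ)} {Q : Eu n × ℝ → ℝ} (hQ : EqOn (fun z => F z - G z) Q A) (p : ℝ) :
    sobolevNorm A p Q ≤
      ((∫⁻ z in A, ‖F z - G z‖ₑ ^ p)
        + (∑ i, ∫⁻ z in A, ‖lineDeriv ℝ F z (EuclideanSpace.single i 1, 0)
            - lineDeriv ℝ G z (EuclideanSpace.single i 1, 0)‖ₑ ^ p)
        + ∫⁻ z in A, ‖lineDeriv ℝ F z (0, 1) - lineDeriv ℝ G z (0, 1)‖ₑ ^ p) ^ (1 / p) := by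
  have hd := fun v => (isWeakDeriv_univ_of_lipschitzWith hF v).sub_univ
    (isWeakDeriv_univ_of_contDiff hG v)
  exact iInf_le_of_le univ <| iInf_le_of_le _ <| iInf_le_of_le (fun i z => _) <| iInf_le_of_le _ <|
    iInf_le_of_le ⟨isOpen_univ, subset_univ _, hQ, fun i => hd _, hd _⟩ le_rfl

end WeakDerivative

/-- Bounded convergence in `L^p`, on a possibly non-measurable subset of a compact set. -/
theorem tendsto_setLIntegral_enorm_rpow_zero {E : Type*} [TopologicalSpace E] [T2Space E]
    [MeasurableSpace E] [OpensMeasurableSpace E] {μ : Measure E} [IsFiniteMeasureOnCompacts μ]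
    {A B : Set E} (hAB : A ⊆ B) (hB : IsCompact B) {p : ℝ} (hp : 0 < p) {h : ℕ → E → ℝ} {D : ℝ}
    (hm : ∀ k, Measurable (h k)) (hD : ∀ k, ∀ z ∈ B, |h k z| ≤ D)
    (hlim : ∀ᵐ z ∂μ, z ∈ B → Filter.Tendsto (fun k => h k z) Filter.atTop (nhds 0)) :
    Filter.Tendsto (fun k => ∫⁻ z in A, ‖h k z‖ₑ ^ p ∂μ) Filter.atTop (nhds 0) := by
  have key : Filter.Tendsto (fun k => ∫⁻ z in B, ‖h k z‖ₑ ^ p ∂μ) Filter.atTop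
      (nhds (∫⁻ _ in B, 0 ∂μ)) := by
    refine tendsto_lintegral_of_dominated_convergence (fun _ => ENNReal.ofReal D ^ p)
      (fun k => (hm k).enorm.pow_const p) (fun k => ?_) ?_ ?_
    · filter_upwards [ae_restrict_mem hB.measurableSet] with z hz
      gcongr
      rw [← ofReal_norm]
      exact ENNReal.ofReal_le_ofReal (hD k z hz)
    · rw [setLIntegral_const]
      exact ENNReal.mul_ne_top (ENNReal.rpow_ne_top_of_nonneg hp.le ENNReal.ofReal_ne_top)
        hB.measure_lt_top.ne
    · rw [ae_restrict_iff' hB.measurableSet]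
      filter_upwards [hlim] with z hz hzB
      have h1 := ((ENNReal.continuous_rpow_const (y := p)).comp
        (continuous_enorm (E := ℝ))).tendsto 0 |>.comp (hz hzB)
      simpa [Function.comp_def, ENNReal.zero_rpow_of_pos hp] using h1
  rw [lintegral_zero] at key
  exact tendsto_of_tendsto_of_tendsto_of_le_of_le tendsto_const_nhds key (fun _ => zero_le)
    fun k => lintegral_mono_set hAB

/-! ### Comparison with the state-constrained problem -/

section Comparison

variable {n m : ℕ} {c c' : Eu n → Eu m → ℝ → ℝ} {g g' : Eu n → ℝ} {f f' : Eu n → Eu m → Eu n}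
  {Ω B : Set (Eu n)} {U : Set (Eu m)} {T : ℝ} {K : ℝ≥0}

/-- Trajectories of a locally Lipschitz vector field are unique. -/
theorem IsTrajectory.eqOn_of_locLip (hΩ : LocLip (Ω ×ˢ U) (fun z : Eu n × Eu m => f z.1 z.2))
    (hU : IsCompact U) {x : Eu n} {t : ℝ} {u : ℝ → Eu m} (hu : ∀ s ∈ Icc t T, u s ∈ U)
    {φ ψ : ℝ → Eu n} (hφ : IsTrajectory f Ω T x t u φ) (hψ : IsTrajectory f Ω T x t u ψ) :
    EqOn ψ φ (Icc t T) := by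
  set S := φ '' Icc t T ∪ ψ '' Icc t T
  have hS : IsCompact S := (isCompact_Icc.image_of_continuousOn hφ.continuousOn).union
    (isCompact_Icc.image_of_continuousOn hψ.continuousOn)
  have hSΩ : S ⊆ Ω := union_subset (image_subset_iff.2 hφ.mem) (image_subset_iff.2 hψ.mem)
  obtain ⟨L, hL⟩ := hΩ (S ×ˢ U) (prod_mono hSΩ Subset.rfl) (hS.prod hU)
  intro s hs
  have := hψ.dist_le_of_lipschitzOn hφ hL (fun r hr => Or.inr (mem_image_of_mem _ hr))
    (fun r hr => Or.inl (mem_image_of_mem _ hr)) hu s hs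
  rw [sub_self, norm_zero, zero_mul] at this
  exact sub_eq_zero.1 (norm_le_zero_iff.1 this)

/-- Trajectories of the extended system that start in the set `Λ` stay in `Ω`: they are
trajectories of the original system as long as they stay in `B`, and moving with bounded speed
they need a fixed amount of time to get from `Ω` out of `B`. -/
theorem IsTrajectory.mem_of_forwardReach_subset {Λ : Set (Eu n)} (hΛΩ : Λ ⊆ Ω)
    (h : IsBoundedLipschitzOCP K c' g' f')
    (hf : LocLip (univ ×ˢ U) (fun z : Eu n × Eu m => f z.1 z.2)) (hU : IsCompact U)
    (hFR : forwardReach f Λ univ U (Icc 0 T) ⊆ Ω)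
    (hΩB : ∀ x ∈ Ω, ∀ y, ‖y - x‖ ≤ 1 → y ∈ B)
    (hff : ∀ x ∈ B, ∀ v ∈ U, f' x v = f x v) {x : Eu n} (hx : x ∈ Λ) {t : ℝ}
    (ht : t ∈ Icc 0 T) {u : ℝ → Eu m} (hu : Measurable u) (huU : ∀ s, u s ∈ U) {φ : ℝ → Eu n}
    (hφ : IsTrajectory f' univ T x t u φ) : ∀ s ∈ Icc t T, φ s ∈ Ω := by
  have hstep : ∀ k : ℕ, ∀ s ∈ Icc t T, (K + 1) * (s - t) ≤ k → φ s ∈ Ω := by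
    -- induction over time steps of length `1 / (K + 1)`
    intro k
    induction k with
    | zero =>
      intro s hs hk
      have : s = t := by
        have hK : (0 : ℝ) ≤ K := K.2
        rw [Nat.cast_zero] at hk
        nlinarith [hs.1]
      rw [this, hφ.initial ht.2]
      exact hΛΩ hx
    | succ k ih =>
      intro s hs hk
      -- an earlier state `φ q`, with `r - q ≤ 1 / (K + 1)`, lies in `Ω` by induction
      have hB : ∀ r ∈ Icc t s, φ r ∈ B := by
        intro r hr
        set q := max t (r - 1 / (K + 1)) with hq
        have hK : (0 : ℝ) < K + 1 := by positivity
        have hqr : q ≤ r := max_le hr.1 (by linarith [one_div_pos.2 hK])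
        have hqt : t ≤ q := le_max_left _ _
        have hrk : (K + 1) * (r - t) ≤ k + 1 := by
          refine le_trans ?_ (hk.trans_eq (by push_cast; rfl))
          gcongr
          exact hr.2
        have hqΩ : φ q ∈ Ω := by
          refine ih q ⟨hqt, (hqr.trans hr.2).trans hs.2⟩ ?_
          rcases max_cases t (r - 1 / ((K : ℝ) + 1)) with ⟨h1, -⟩ | ⟨h1, -⟩
          · rw [hq, h1]; simp
          · rw [hq, h1]
            have : (K + 1 : ℝ) * (r - 1 / (K + 1) - t) = (K + 1) * (r - t) - 1 := by
              field_simp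
              ring
            linarith
        refine hΩB _ hqΩ _ ((hφ.norm_sub_le h.bound_f hqt hqr (hr.2.trans hs.2)).trans ?_)
        have h1 : r - q ≤ 1 / (K + 1) := by linarith [le_max_right t (r - 1 / ((K : ℝ) + 1))]
        calc (K : ℝ) * (r - q) ≤ (K + 1) * (1 / (K + 1)) :=
              mul_le_mul (by linarith) h1 (sub_nonneg.2 hqr) hK.le
          _ = 1 := by field_simp
      -- the system is autonomous: shifted to start at time `0`, `φ` is covered by `hFR`
      have h1 : IsTrajectory f univ s x t u φ := (hφ.restrict hs.1 hs.2).congr hs.1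
        (fun _ _ => rfl) (fun r hr => (hff _ (hB r hr) _ (huU r)).symm) (fun _ _ => mem_univ _)
      have h2 := h1.shift t
      rw [sub_self] at h2
      refine hFR ⟨x, hx, s - t, ⟨sub_nonneg.2 hs.1, by linarith [ht.1, hs.2]⟩,
        fun r => u (r + t), ⟨hu.comp (measurable_id.add_const t), fun _ _ => huU _, _, h2,
          fun y hy => h2.eqOn_of_locLip hf hU (fun _ _ => huU _) hy⟩, _, h2, by simp⟩
  intro s hs
  obtain ⟨k, hk⟩ := exists_nat_ge ((K + 1) * (s - t))
  exact hstep k s hs hk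

theorem freeValue_le_optimalCost (h : IsBoundedLipschitzOCP K c' g' f') (hU : U.Nonempty)
    (hcc : ∀ x ∈ Ω, ∀ v ∈ U, ∀ t ∈ Icc 0 T, c' x v t = c x v t) (hgg : ∀ x ∈ Ω, g' x = g x)
    (hff : ∀ x ∈ Ω, ∀ v ∈ U, f' x v = f x v) {t : ℝ} (ht : t ∈ Icc 0 T) (x : Eu n) :
    (freeValue c' g' f' U T x t : EReal) ≤ optimalCost c g f Ω U T x t := by
  obtain ⟨v, hv⟩ := hU
  refine le_iInf₂ fun u hu => le_iInf₂ fun φ hφ => EReal.coe_le_coe_iff.2 ?_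
  classical
  -- inputs in `costSet` must take values in `U` outside `[t, T]` too
  set u' := (Icc t T).piecewise u (fun _ => v)
  have hu' : EqOn u' u (Icc t T) := piecewise_eqOn _ _ _
  have hφ' : IsTrajectory f' univ T x t u' φ := hφ.congr ht.2 (fun _ _ => rfl)
    (fun s hs => by rw [hu' hs]; exact hff _ (hφ.mem s hs) _ (hu.2.1 s hs)) (fun _ _ => mem_univ _)
  have h1 := h.freeValue_le ht.2 (hu.1.piecewise measurableSet_Icc measurable_const)
    (fun s => by
      by_cases hs : s ∈ Icc t T
      · rw [piecewise_eq_of_mem _ _ _ hs]; exact hu.2.1 s hs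
      · rwa [piecewise_eq_of_notMem _ _ _ hs]) hφ'
  rw [hgg _ (hφ.mem T (right_mem_Icc.2 ht.2))] at h1
  refine h1.trans_eq ?_
  congr 1
  refine intervalIntegral.integral_congr fun s hs => ?_
  rw [uIcc_of_le ht.2] at hs
  change c' (φ s) (u' s) s = c (φ s) (u s) s
  rw [hu' hs]
  exact hcc _ (hφ.mem s hs) _ (hu.2.1 s hs) _ ⟨ht.1.trans hs.1, hs.2⟩

/-- If the trajectories of the extended system from `(x, t)` stay in `Ω`, then the state constraint
is void at `(x, t)` and the constrained and the unconstrained optimal costs agree. -/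
theorem optimalCost_eq_freeValue (h : IsBoundedLipschitzOCP K c' g' f') (hU : U.Nonempty)
    (hcc : ∀ x ∈ Ω, ∀ v ∈ U, ∀ t ∈ Icc 0 T, c' x v t = c x v t) (hgg : ∀ x ∈ Ω, g' x = g x)
    (hff : ∀ x ∈ Ω, ∀ v ∈ U, f' x v = f x v) {t : ℝ} (ht : t ∈ Icc 0 T) {x : Eu n}
    (hUc : IsCompact U) (hf : LocLip (Ω ×ˢ U) (fun z : Eu n × Eu m => f z.1 z.2))
    (hmem : ∀ (u : ℝ → Eu m) (φ : ℝ → Eu n), Measurable u → (∀ s, u s ∈ U) →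
      IsTrajectory f' univ T x t u φ → ∀ s ∈ Icc t T, φ s ∈ Ω) :
    optimalCost c g f Ω U T x t = freeValue c' g' f' U T x t := by
  have hle : ∀ J ∈ costSet c' g' f' U T x t, optimalCost c g f Ω U T x t ≤ (J : EReal) := by
    rintro J ⟨u, φ, hu, huU, hφ, rfl⟩
    have hφΩ := hmem u φ hu huU hφ
    have hφ' : IsTrajectory f Ω T x t u φ := hφ.congr ht.2 (fun _ _ => rfl)
      (fun s hs => (hff _ (hφΩ s hs) _ (huU s)).symm) hφΩ
    refine (iInf₂_le u ⟨hu, fun s _ => huU s, φ, hφ', fun y hy =>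
      hφ'.eqOn_of_locLip hf hUc (fun s _ => huU s) hy⟩).trans ((iInf₂_le φ hφ').trans (le_of_eq ?_))
    rw [hgg _ (hφΩ T (right_mem_Icc.2 ht.2))]
    congr 2
    refine intervalIntegral.integral_congr fun s hs => ?_
    rw [uIcc_of_le ht.2] at hs
    exact (hcc _ (hφΩ s hs) _ (huU s) _ ⟨ht.1.trans hs.1, hs.2⟩).symm
  have hge := freeValue_le_optimalCost h hU hcc hgg hff ht x
  refine le_antisymm ?_ hge
  obtain ⟨J₀, hJ₀⟩ := h.costSet_nonempty (U := U) hU ht.2 x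
  have htop : optimalCost c g f Ω U T x t ≠ ⊤ := ((hle J₀ hJ₀).trans_lt (EReal.coe_lt_top _)).ne
  have hbot : optimalCost c g f Ω U T x t ≠ ⊥ := ((EReal.bot_lt_coe _).trans_le hge).ne'
  rw [← EReal.coe_toReal htop hbot] at hle ⊢
  exact EReal.coe_le_coe_iff.2
    (le_csInf ⟨J₀, hJ₀⟩ fun J hJ => EReal.coe_le_coe_iff.1 (hle J hJ))

end Comparison

/-! ### The dissipative minorant -/

/-- The polynomial `P(x, t) + σ (t - a)`. For `σ > 0` it has a larger time derivative than `P`, and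
smaller values at the times before `a`. -/
noncomputable def addTimeSlope {n : ℕ} (P : MvPolynomial (Fin n ⊕ Unit) ℝ) (σ a : ℝ) :
    MvPolynomial (Fin n ⊕ Unit) ℝ :=
  P + MvPolynomial.C σ * (MvPolynomial.X (Sum.inr ()) - MvPolynomial.C a)

theorem polyEval_addTimeSlope {n : ℕ} (P : MvPolynomial (Fin n ⊕ Unit) ℝ) (σ a : ℝ)
    (x : Eu n) (t : ℝ) : polyEval (addTimeSlope P σ a) x t = polyEval P x t + σ * (t - a) := by
  simp [polyEval, addTimeSlope]

theorem lineDeriv_polyEval_addTimeSlope {n : ℕ} (P : MvPolynomial (Fin n ⊕ Unit) ℝ) (σ a : ℝ)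
    (z v : Eu n × ℝ) :
    lineDeriv ℝ (fun z : Eu n × ℝ => polyEval (addTimeSlope P σ a) z.1 z.2) z v
      = lineDeriv ℝ (fun z : Eu n × ℝ => polyEval P z.1 z.2) z v + σ * v.2 := by
  simp only [polyEval_addTimeSlope]
  have h1 : HasLineDerivAt ℝ (fun z : Eu n × ℝ => polyEval P z.1 z.2) _ z v :=
    ((contDiff_polyEval P).differentiable (by simp) z).lineDifferentiableAt.hasLineDerivAt
  have h2 : HasLineDerivAt ℝ (fun z : Eu n × ℝ => σ * (z.2 - a)) (σ * v.2) z v := by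
    have : HasDerivAt (fun r : ℝ => σ * (z.2 + r * v.2 - a)) (σ * (1 * v.2)) 0 :=
      ((((hasDerivAt_id (0 : ℝ)).mul_const v.2).const_add z.2).sub_const a).const_mul σ
    simpa [HasLineDerivAt] using this
  exact HasLineDerivAt.lineDeriv (HasDerivAt.add h1 h2)

/-- The total derivative of a polynomial along a velocity `v` is its line derivative in the
direction `(v, 1)`. -/
theorem deriv_add_inner_gradient_eq_lineDeriv {n : ℕ} (P : MvPolynomial (Fin n ⊕ Unit) ℝ)
    (x v : Eu n) (t : ℝ) :
    deriv (fun s => polyEval P x s) t + inner ℝ (gradient (fun y => polyEval P y t) x) v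
      = lineDeriv ℝ (fun z : Eu n × ℝ => polyEval P z.1 z.2) (x, t) (v, 1) := by
  have hd : DifferentiableAt ℝ (fun z : Eu n × ℝ => polyEval P z.1 z.2) (x, t) :=
    (contDiff_polyEval P).differentiable (by simp) _
  have h1 : HasDerivAt (fun s => polyEval P x s)
      (fderiv ℝ (fun z : Eu n × ℝ => polyEval P z.1 z.2) (x, t) (0, 1)) t :=
    hd.hasFDerivAt.comp_hasDerivAt (f := fun s => (x, s)) t
      ((hasDerivAt_const t x).prodMk (hasDerivAt_id t))
  have h2 : HasFDerivAt (fun y => polyEval P y t)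
      ((fderiv ℝ (fun z : Eu n × ℝ => polyEval P z.1 z.2) (x, t)).comp
        (ContinuousLinearMap.inl ℝ (Eu n) ℝ)) x :=
    HasFDerivAt.comp (f := fun y => (y, t)) x hd.hasFDerivAt (hasFDerivAt_prodMk_left x t)
  rw [hd.lineDeriv_eq_fderiv, h1.deriv, inner_gradient_left, h2.fderiv]
  simp [← map_add]

/-- The extended and truncated value function: a compactly supported Lipschitz function that lies
below the optimal cost on `Ω × [0, T]`, with equality on `Λ × [0, T]`, has the right terminal
values, and satisfies the dissipation inequality almost everywhere. The inequality is stated with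
the velocity and the cost frozen at the centre of a small ball, the form in which it can be
mollified. -/
theorem exists_lipschitz_dissipative_minorant {n m : ℕ} {c : Eu n → Eu m → ℝ → ℝ} {g : Eu n → ℝ}
    {f : Eu n → Eu m → Eu n} {Ω : Set (Eu n)} {U : Set (Eu m)} {T : ℝ} (hT : 0 < T)
    (hOCP : IsLipschitzOCP c g f Ω U T) (hΩ : IsCompact Ω) (hU : U.Nonempty)
    (hf : LocLip (univ ×ˢ U) (fun z : Eu n × Eu m => f z.1 z.2)) {Λ : Set (Eu n)} (hΛΩ : Λ ⊆ Ω)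
    (hFR : forwardReach f Λ univ U (Icc 0 T) ⊆ Ω) :
    ∃ (w : Eu n × ℝ → ℝ) (L : ℝ≥0) (M R C K : ℝ), LipschitzWith L w ∧ (∀ z, |w z| ≤ M) ∧
      (∀ z, R < ‖z‖ → w z = 0) ∧ 0 ≤ C ∧
      (∀ x ∈ Ω, ∀ t ∈ Icc 0 T, ‖(x, t)‖ ≤ R) ∧
      (∀ x ∈ Λ, ∀ t ∈ Icc 0 T, optimalCost c g f Ω U T x t = w (x, t)) ∧
      (∀ x ∈ Ω, ∀ t ∈ Icc 0 T, (w (x, t) : EReal) ≤ optimalCost c g f Ω U T x t) ∧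
      (∀ x ∈ Ω, w (x, T) = g x) ∧
      (∀ x ∈ Ω, ∀ v ∈ U, ‖f x v‖ ≤ K) ∧
      (∀ x ∈ Ω, ∀ v ∈ U, ∀ t ∈ Icc 0 T, ∀ δ ≤ 1, ∀ᵐ y : Eu n × ℝ, dist y (x, t) < δ →
        - c x v t - C * δ ≤ lineDeriv ℝ w y (f x v, 1)) := by
  obtain ⟨R₀, hR₀⟩ := hΩ.isBounded.exists_norm_le
  obtain ⟨K, c', g', f', h, hcc, hgg, hff⟩ := exists_isBoundedLipschitzOCP hOCP hΩ hf
    (isCompact_closedBall (0 : Eu n) (R₀ + 1))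
  have hΩB : ∀ x ∈ Ω, ∀ y, ‖y - x‖ ≤ 1 → y ∈ Metric.closedBall (0 : Eu n) (R₀ + 1) := by
    intro x hx y hy
    rw [mem_closedBall_zero_iff]
    linarith [norm_le_norm_add_norm_sub x y, norm_sub_rev x y, hR₀ x hx]
  have hff' : ∀ x ∈ Ω, ∀ v ∈ U, f' x v = f x v := fun x hx => hff x (hΩB x hx x (by simp))
  set W := extendedValue K c' g' f' U T
  obtain ⟨L, hL⟩ := h.exists_lipschitzWith_extendedValue hU hT
  let M : ℝ≥0 := Real.toNNReal (K * (T + 1) + K + (K + K * K))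
  have hWM : ∀ z : Eu n × ℝ, z.2 ≤ T + 1 → |W z| ≤ M := fun z hz =>
    (h.abs_extendedValue_le hU hT z hz).trans (Real.le_coe_toNNReal _)
  set R := max R₀ T + 2
  have hR : 0 ≤ R := by linarith [le_max_right R₀ T]
  obtain ⟨w, L', hw, hwM, hw0, hwW⟩ := exists_lipschitz_truncation (M := M) hL hR
  have hnorm : ∀ x ∈ Ω, ∀ t ∈ Icc 0 T, ‖(x, t)‖ ≤ R - 2 := by
    intro x hx t ht
    rw [Prod.norm_mk, Real.norm_of_nonneg ht.1, add_sub_cancel_right]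
    exact max_le_max (hR₀ x hx) ht.2
  have hwV : ∀ x ∈ Ω, ∀ t ∈ Icc 0 T, w (x, t) = freeValue c' g' f' U T x t := by
    intro x hx t ht
    have hz := hnorm x hx t ht
    rw [hwW _ (by linarith) (hWM _ (by linarith [ht.2])),
      IsBoundedLipschitzOCP.extendedValue_eq ⟨by linarith [ht.1], ht.2⟩]
  refine ⟨w, L', M * R, R, L * K + K, K, hw, hwM, hw0, by positivity, ?_, ?_, ?_, ?_, ?_, ?_⟩
  · intro x hx t ht
    linarith [hnorm x hx t ht]
  · intro x hx t ht
    rw [hwV x (hΛΩ hx) t ht]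
    exact optimalCost_eq_freeValue h hU hcc hgg hff' ht hOCP.isCompact_U hOCP.locLip_f
      fun u φ hu huU hφ => IsTrajectory.mem_of_forwardReach_subset hΛΩ h hf hOCP.isCompact_U hFR
        hΩB hff hx ht hu huU hφ
  · intro x hx t ht
    rw [hwV x hx t ht]
    exact freeValue_le_optimalCost h hU hcc hgg hff' ht x
  · intro x hx
    rw [hwV x hx T ⟨hT.le, le_rfl⟩, h.freeValue_terminal hU, hgg x hx]
  · intro x hx v hv
    rw [← hff' x hx v hv]
    exact h.bound_f x v
  · intro x hx v hv t ht δ hδ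
    -- at a point of differentiability, so almost everywhere, the direction can be split
    filter_upwards [hL.ae_differentiableAt (μ := volume)] with y hy hyz
    have hz := hnorm x hx t ht
    have hy1 : ‖y‖ < R - 1 := by
      have h1 := norm_le_norm_add_norm_sub (x, t) y
      rw [← dist_eq_norm, dist_comm] at h1
      linarith
    have hyx : ‖x - y.1‖ ≤ δ := by
      rw [← dist_eq_norm, dist_comm]
      exact (le_max_left _ _).trans hyz.le
    have hyt : |y.2 - t| < δ := by
      rw [← Real.dist_eq]
      exact (le_max_right _ _).trans_lt hyz
    have hyt' := abs_lt.1 hyt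
    have hev : w =ᶠ[nhds y] W := by
      have hopen : IsOpen {z : Eu n × ℝ | ‖z‖ < R - 1 ∧ z.2 < T + 1} :=
        (isOpen_lt continuous_norm continuous_const).inter
          (isOpen_lt continuous_snd continuous_const)
      filter_upwards [hopen.mem_nhds ⟨hy1, by linarith [ht.2]⟩] with z hz
      exact hwW z hz.1.le (hWM z hz.2.le)
    have h1 : - c' y.1 v y.2 ≤ fderiv ℝ W y (f' y.1 v, 1) :=
      h.neg_cost_le_of_hasLineDerivAt hU hT hv (by linarith [ht.1])
        (hy.hasFDerivAt.hasLineDerivAt _)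
    have h2 : c' y.1 v y.2 ≤ c x v t + K * δ := by
      rw [← hcc x hx v hv t ht]
      have := h.lip_c.dist_le_mul (y.1, v, y.2) (x, v, t)
      rw [Real.dist_eq] at this
      have h3 : dist (y.1, v, y.2) (x, v, t) ≤ δ := by
        change max (dist y.1 x) (max (dist v v) (dist y.2 t)) ≤ δ
        rw [dist_self, dist_comm, dist_eq_norm, Real.dist_eq]
        exact max_le hyx (max_le ((abs_nonneg _).trans hyt.le) hyt.le)
      have h4 : (K : ℝ) * dist (y.1, v, y.2) (x, v, t) ≤ K * δ := by gcongr
      linarith [(abs_le.1 this).2]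
    have h3 : fderiv ℝ W y (f x v, 1) = fderiv ℝ W y (f' y.1 v, 1)
        + fderiv ℝ W y (f' x v - f' y.1 v, 0) := by
      rw [← map_add, hff' x hx v hv]
      simp
    have h4 : |fderiv ℝ W y (f' x v - f' y.1 v, 0)| ≤ L * K * δ := by
      refine (ContinuousLinearMap.le_of_opNorm_le _ (norm_fderiv_le_of_lipschitz ℝ hL) _).trans ?_
      rw [Prod.norm_mk, norm_zero, max_eq_left (norm_nonneg _), mul_assoc]
      gcongr
      have h5 := h.lip_f.dist_le_mul (x, v) (y.1, v)
      rw [Prod.dist_eq, dist_self, max_eq_left dist_nonneg, dist_eq_norm, dist_eq_norm] at h5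
      exact h5.trans (by gcongr)
    rw [hev.lineDeriv_eq, hy.lineDeriv_eq_fderiv, h3]
    have := (abs_le.1 h4).1
    linarith

/-! ### Existence of the approximating polynomials -/

theorem mainTheorem4 {n m : ℕ} (c : Eu n → Eu m → ℝ → ℝ) (g : Eu n → ℝ)
    (f : Eu n → Eu m → Eu n) (Ω : Set (Eu n)) (U : Set (Eu m)) (T : ℝ) (hT : 0 < T)
    (hOCP : IsLipschitzOCP c g f Ω U T)
    (hΩ : IsCompact Ω) (hU : U.Nonempty)
    (hf : LocLip (Set.univ ×ˢ U) (fun z : Eu n × Eu m => f z.1 z.2))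
    (Λ : Set (Eu n)) (hΛΩ : Λ ⊆ Ω) (hΛ : Bornology.IsBounded Λ)
    (hFR : forwardReach f Λ Set.univ U (Set.Icc 0 T) ⊆ Ω)
    (V : Eu n → ℝ → EReal) (hV : IsValueFunction c g f Ω U T V) :
    (∀ x ∈ Λ, ∀ t ∈ Set.Icc 0 T, V x t ≠ ⊤ ∧ V x t ≠ ⊥) ∧
    ∀ p : ℝ, 1 ≤ p → ∀ ε : ℝ, 0 < ε →
      ∃ P : MvPolynomial (Fin n ⊕ Unit) ℝ,
        sobolevNorm (Λ ×ˢ Set.Icc 0 T) p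
            (fun z => (V z.1 z.2).toReal - polyEval P z.1 z.2) < ENNReal.ofReal ε ∧
        (⨆ x ∈ Λ, ⨆ t ∈ Set.Icc 0 T, ‖(V x t).toReal - polyEval P x t‖ₑ) < ENNReal.ofReal ε ∧
        (∀ x ∈ Ω, ∀ t ∈ Set.Icc 0 T, ((polyEval P x t : ℝ) : EReal) ≤ V x t) ∧
        (∀ x ∈ Ω, ∀ u ∈ U, ∀ t ∈ Set.Ioo 0 T,
          0 < deriv (fun s => polyEval P x s) t + c x u t
            + inner ℝ (gradient (fun y => polyEval P y t) x) (f x u)) ∧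
        (∀ x ∈ Ω, polyEval P x T < g x) := by
  obtain ⟨w, L, M, R, C₁, K, hw, hwM, hw0, hC₁, hR, hwΛ, hwΩ, hwT, hK, hdiss⟩ :=
    exists_lipschitz_dissipative_minorant hT hOCP hΩ hU hf hΛΩ hFR
  have hVΛ : ∀ x ∈ Λ, ∀ t ∈ Icc 0 T, V x t = (w (x, t) : EReal) := fun x hx t ht => by
    rw [hV x (hΛΩ hx) t ht, hwΛ x hx t ht]
  refine ⟨fun x hx t ht => by simp [hVΛ x hx t ht], fun p hp ε hε => ?_⟩
  have hp0 : 0 < p := by linarith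
  obtain ⟨P, C₂, hC₂, hP, hPlim, hPbd, hPdiss⟩ := exists_polyEval_approx_lipschitz hw hwM hw0
  -- `D` dominates both the uniform error and the loss in the dissipation inequality
  set D := C₂ + C₁ + C₂ * max K 1 + 1 with hD
  have hD1 : 0 ≤ C₂ * max K 1 := by positivity
  have hDpos : 0 < D := by positivity
  set σ : ℕ → ℝ := fun k => D / (k + 1)
  have hk0 : ∀ k : ℕ, (0 : ℝ) < k + 1 := fun k => by positivity
  have hσ0 : ∀ k, 0 < σ k := fun k => div_pos hDpos (hk0 k)
  have hσD : ∀ k, σ k ≤ D := fun k =>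
    div_le_self hDpos.le (by linarith [(Nat.cast_nonneg k : (0 : ℝ) ≤ k)])
  have hσ : Filter.Tendsto σ Filter.atTop (nhds 0) := by
    simpa [σ, div_eq_mul_inv] using
      (tendsto_one_div_add_atTop_nhds_zero_nat (𝕜 := ℝ)).const_mul D
  set Q : ℕ → MvPolynomial (Fin n ⊕ Unit) ℝ := fun k => addTimeSlope (P k) (2 * σ k) (T + 1)
    with hQdef
  have hQ : ∀ k x t, polyEval (Q k) x t = polyEval (P k) x t + 2 * σ k * (t - (T + 1)) :=
    fun k x t => polyEval_addTimeSlope _ _ _ _ _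
  have hQd : ∀ k z v, lineDeriv ℝ (fun z : Eu n × ℝ => polyEval (Q k) z.1 z.2) z v
      = lineDeriv ℝ (fun z : Eu n × ℝ => polyEval (P k) z.1 z.2) z v + 2 * σ k * v.2 :=
    fun k z v => lineDeriv_polyEval_addTimeSlope _ _ _ _ _
  have hPσ : ∀ k z, ‖z‖ ≤ R → |polyEval (P k) z.1 z.2 - w z| ≤ σ k := fun k z hz =>
    (hP k z hz).trans (div_le_div_of_nonneg_right (by linarith) (hk0 k).le)
  have hQw : ∀ k, ∀ x ∈ Ω, ∀ t ∈ Icc 0 T, polyEval (Q k) x t < w (x, t) := by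
    intro k x hx t ht
    have h1 := (abs_le.1 (hPσ k (x, t) (hR x hx t ht))).2
    rw [hQ]
    nlinarith [hσ0 k, ht.2]
  have hAB : Λ ×ˢ Icc 0 T ⊆ Metric.closedBall (0 : Eu n × ℝ) R := fun z hz =>
    mem_closedBall_zero_iff.2 (hR z.1 (hΛΩ hz.1) z.2 hz.2)
  have hBc := isCompact_closedBall (0 : Eu n × ℝ) R
  have hQs : ∀ k, ContDiff ℝ ∞ fun z : Eu n × ℝ => polyEval (Q k) z.1 z.2 := fun k =>
    contDiff_polyEval _
  have hval : Filter.Tendsto (fun k => ∫⁻ z in Λ ×ˢ Icc 0 T, ‖w z - polyEval (Q k) z.1 z.2‖ₑ ^ p)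
      Filter.atTop (nhds 0) := by
    have hbd : ∀ k, ∀ z ∈ Metric.closedBall (0 : Eu n × ℝ) R,
        |w z - polyEval (Q k) z.1 z.2| ≤ σ k * (1 + 2 * (R + |T + 1|)) := by
      intro k z hz
      rw [mem_closedBall_zero_iff] at hz
      have h1 := hPσ k z hz
      rw [abs_sub_comm] at h1
      have h2 : |z.2 - (T + 1)| ≤ R + |T + 1| :=
        (abs_sub _ _).trans (by gcongr; exact (norm_snd_le z).trans hz)
      calc |w z - polyEval (Q k) z.1 z.2|
          = |(w z - polyEval (P k) z.1 z.2) + -(2 * σ k * (z.2 - (T + 1)))| := by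
            rw [hQ]; congr 1; ring
        _ ≤ σ k + 2 * σ k * (R + |T + 1|) := by
            refine (abs_add_le _ _).trans (add_le_add h1 ?_)
            rw [abs_neg, abs_mul, abs_of_pos (by linarith [hσ0 k] : 0 < 2 * σ k)]
            have := hσ0 k
            gcongr
        _ = _ := by ring
    refine tendsto_setLIntegral_enorm_rpow_zero hAB hBc hp0
      (D := D * (1 + 2 * (R + |T + 1|)))
      (fun k => (hw.continuous.sub (hQs k).continuous).measurable) (fun k z hz => ?_)
      (ae_of_all _ fun z hz => ?_)
    · have hR0 : 0 ≤ R := (norm_nonneg z).trans (mem_closedBall_zero_iff.1 hz)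
      exact (hbd k z hz).trans (by gcongr; exact hσD k)
    · refine squeeze_zero_norm (fun k => (Real.norm_eq_abs _).trans_le (hbd k z hz)) ?_
      simpa using hσ.mul_const (1 + 2 * (R + |T + 1|))
  have hder : ∀ v : Eu n × ℝ, Filter.Tendsto (fun k => ∫⁻ z in Λ ×ˢ Icc 0 T,
      ‖lineDeriv ℝ w z v - lineDeriv ℝ (fun z : Eu n × ℝ => polyEval (Q k) z.1 z.2) z v‖ₑ ^ p)
      Filter.atTop (nhds 0) := by
    intro v
    refine tendsto_setLIntegral_enorm_rpow_zero hAB hBc hp0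
      (D := L * ‖v‖ + ((L + C₂) * ‖v‖ + 2 * D * |v.2|))
      (fun k => (measurable_lineDeriv hw.continuous).sub
        (measurable_lineDeriv (hQs k).continuous)) (fun k z hz => ?_) ?_
    · rw [hQd]
      refine (abs_sub _ _).trans (add_le_add (norm_lineDeriv_le_of_lipschitz ℝ hw)
        ((abs_add_le _ _).trans (add_le_add (hPbd v k z (mem_closedBall_zero_iff.1 hz)) ?_)))
      rw [abs_mul, abs_of_pos (by linarith [hσ0 k] : 0 < 2 * σ k)]
      gcongr
      exact hσD k
    · filter_upwards [hPlim v] with z hz hzB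
      have h1 := (hz (mem_closedBall_zero_iff.1 hzB)).add ((hσ.const_mul 2).mul_const v.2)
      have h2 := h1.const_sub (lineDeriv ℝ w z v)
      simpa [hQd] using h2
  have hsob : Filter.Tendsto (fun k => ((∫⁻ z in Λ ×ˢ Icc 0 T, ‖w z - polyEval (Q k) z.1 z.2‖ₑ ^ p)
        + (∑ i : Fin n, ∫⁻ z in Λ ×ˢ Icc 0 T, ‖lineDeriv ℝ w z (EuclideanSpace.single i 1, 0)
            - lineDeriv ℝ (fun z : Eu n × ℝ => polyEval (Q k) z.1 z.2) z
              (EuclideanSpace.single i 1, 0)‖ₑ ^ p)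
        + ∫⁻ z in Λ ×ˢ Icc 0 T, ‖lineDeriv ℝ w z (0, 1)
            - lineDeriv ℝ (fun z : Eu n × ℝ => polyEval (Q k) z.1 z.2) z (0, 1)‖ₑ ^ p) ^ (1 / p))
      Filter.atTop (nhds 0) := by
    have h1 := (hval.add (tendsto_finsetSum Finset.univ fun (i : Fin n) _ =>
      hder (EuclideanSpace.single i 1, 0))).add (hder (0, 1))
    have h2 := ((ENNReal.continuous_rpow_const (y := 1 / p)).tendsto _).comp h1
    simpa [Function.comp_def, ENNReal.zero_rpow_of_pos (inv_pos.2 hp0)] using h2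
  have hsup : Filter.Tendsto (fun k => σ k * (1 + 2 * (T + 1))) Filter.atTop (nhds 0) := by
    simpa using hσ.mul_const (1 + 2 * (T + 1))
  obtain ⟨k, hk1, hk2⟩ := ((hsob.eventually_lt_const (ENNReal.ofReal_pos.2 hε)).and
    (hsup.eventually_lt_const hε)).exists
  refine ⟨Q k, ?_, ?_, ?_, ?_, ?_⟩
  · refine (sobolevNorm_sub_le hw (hQs k) (fun z hz => ?_) p).trans_lt hk1
    simp only [hVΛ z.1 hz.1 z.2 hz.2, EReal.toReal_coe]
  · refine lt_of_le_of_lt ?_ ((ENNReal.ofReal_lt_ofReal_iff hε).2 hk2)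
    refine iSup₂_le fun x hx => iSup₂_le fun t ht => ?_
    rw [hVΛ x hx t ht, EReal.toReal_coe, ← ofReal_norm, Real.norm_eq_abs]
    refine ENNReal.ofReal_le_ofReal ?_
    have h1 := hPσ k (x, t) (hR x (hΛΩ hx) t ht)
    have h2 := (hQw k x (hΛΩ hx) t ht).le
    rw [abs_of_nonneg (sub_nonneg.2 h2), hQ]
    nlinarith [(abs_le.1 h1).1, hσ0 k, ht.1]
  · intro x hx t ht
    rw [hV x hx t ht]
    exact (EReal.coe_le_coe_iff.2 (hQw k x hx t ht).le).trans (hwΩ x hx t ht)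
  · intro x hx u hu t ht
    have ht' := Ioo_subset_Icc_self ht
    have h1 := hPdiss (f x u, 1) k (x, t) _ (hR x hx t ht')
      (hdiss x hx u hu t ht' (1 / (k + 1)) (by
        rw [div_le_one (hk0 k)]; linarith [(Nat.cast_nonneg k : (0 : ℝ) ≤ k)]))
    have h2 : ‖(f x u, (1 : ℝ))‖ ≤ max K 1 := by
      rw [Prod.norm_mk, norm_one]
      exact max_le_max (hK x hx u hu) le_rfl
    have h3 : C₁ * (1 / (k + 1)) + C₂ * ‖(f x u, (1 : ℝ))‖ / (k + 1) ≤ σ k := by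
      rw [mul_one_div, ← add_div]
      refine div_le_div_of_nonneg_right ?_ (hk0 k).le
      have : C₂ * ‖(f x u, (1 : ℝ))‖ ≤ C₂ * max K 1 := by gcongr
      linarith
    have h4 := deriv_add_inner_gradient_eq_lineDeriv (Q k) x (f x u) t
    rw [hQd, mul_one] at h4
    linarith [hσ0 k]
  · intro x hx
    rw [← hwT x hx]
    exact hQw k x hx T ⟨hT.le, le_rfl⟩
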